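/- Circuit diagrams $c : \mathbb B^n \to \mathbb B^m$ ($n, m \ge 0$) are the well-typed terms built by sequential composition $;$ and parallel composition $\otimes$ (with $\mathbb B^n \otimes \mathbb B^m = \mathbb B^{n+m}$ and $I = \mathbb B^0$) from identities, symmetries $\chi_{n,m} : \mathbb B^{n+m} \to \mathbb B^{m+n}$ and the generators $! : \mathbb B \to I$ (discard), $\Delta : \mathbb B \to \mathbb B^2$ (copy), $\phi : \mathbb B^3 \to \mathbb B$ (if-gate) and $\langle p\rangle : I \to \mathbb B$ for every $p \in [0,1]$. *Semantics.* A diagram $c : \mathbb B^n \to \mathbb B^m$ is interpreted as a stochastic map $[\![c]\!]$ from $\{0,1\}^n$ to $\{0,1\}^m$, that is, a morphism of $\mathsf{FinStoch}_{\{1,0\}}$: $;$ is interpreted as composition $(f;g)(z\mid x) = \sum_y f(y\mid x)\,g(z\mid y)$, $\otimes$ as the product $(f\otimes g)(y,y'\mid x,x') = f(y\mid x)\,g(y'\mid x')$, identities and symmetries as the evident deterministic maps, $!$ and $\Delta$ as discarding and copying a bit, $\langle p\rangle$ as the distribution giving $1$ with probability $p$ and $0$ with probability $1-p$, and $\phi$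 as the deterministic map $(a,1,b) \mapsto a$, $(a,0,b)\mapsto b$. *Derivable equality.* For $A = \mathbb B^n$ define $!_A : A \to I$, $\Delta_A : A \to A\otimes A$, $\phi_A : A \otimes \mathbb B\otimes A \to A$ by induction on $n$: on $I$ they are $\mathrm{id}_I$, $\mathrm{id}_I$ and $!$; on $\mathbb B$ they are the generators; and on $A \otimes C$ they are $!_A \otimes {!_C}$, $(\Delta_A\otimes\Delta_C);(\mathrm{id}_A\otimes\chi_{A,C}\otimes \mathrm{id}_C)$ and $$(\mathrm{id}_{A\otimes C}\otimes\Delta_{\mathbb B}\otimes \mathrm{id}_{A\otimes C});(\mathrm{id}_A\otimes\chi_{C,\mathbb B}\otimes\chi_{\mathbb B,A}\otimes \mathrm{id}_C);(\mathrm{id}_{A\otimes\mathbb B}\otimes\chi_{C,A}\otimes \mathrm{id}_{\mathbb B\otimes C});(\phi_A\otimes\phi_C).$$ Put $\phi^p_A = (\mathrm{id}_A\otimes\langle p\rangle\otimes \mathrm{id}_A);\phi_A$. Derivable equality is the least congruence (with respect to $;$ and $\otimes$) on diagrams of equal type that contains the axioms of strict symmetric monoidal categories and, for all words $A, C$, all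 diagrams $f : A \to C$ and all $p,q,r,t\in[0,1]$: * the above formulas for $!_{A\otimes C}$, $\Delta_{A\otimes C}$, $\phi_{A\otimes C}$, and $\phi_I = {!_{\mathbb B}}$; * $\Delta_A;(\Delta_A\otimes \mathrm{id}_A) = \Delta_A;(\mathrm{id}_A\otimes\Delta_A)$, $\ \Delta_A;(!_A\otimes \mathrm{id}_A) = \mathrm{id}_A$, $\ \Delta_A;\chi_{A,A} = \Delta_A$, $\ f;!_C = {!_A}$; * $\langle 1\rangle;\Delta = \langle 1\rangle\otimes\langle 1\rangle$, $\ \langle 0\rangle;\Delta = \langle 0\rangle\otimes\langle 0\rangle$; * $(\langle 1\rangle\otimes \mathrm{id}_{\mathbb B}\otimes\langle 0\rangle);\phi = \mathrm{id}_{\mathbb B}$, $\ \phi^1_A = \mathrm{id}_A\otimes{!_A}$, $\ \phi_A;f = (f\otimes \mathrm{id}_{\mathbb B}\otimes f);\phi_C$; * $(\Delta_A\otimes \mathrm{id}_{\mathbb B});(\mathrm{id}_A\otimes\chi_{A,\mathbb B});\phi_A = \mathrm{id}_A\otimes{!_{\mathbb B}}$, $\ \phi^p_A = \chi_{A,A};\phi^{1-p}_A$,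 and $(\phi^p_A\otimes \mathrm{id}_A);\phi^q_A = (\mathrm{id}_A\otimes\phi^r_A);\phi^t_A$ whenever $pq = t$ and $(1-r)(1-t) = 1-q$. *Theorem.* The axioms are (sound and) complete for $\mathsf{FinStoch}_{\{1,0\}}$: for any two diagrams $c, d : \mathbb B^n\to\mathbb B^m$ of the same type, $[\![c]\!] = [\![d]\!]$ if and only if $c = d$ is derivable. -/

import Mathlib

/-! ## Boolean stochastic maps -/

/-- The `n`-th power of the Booleans; `true` is the bit `1`, `false` is the bit `0`. -/
abbrev Bits (n : ℕ) : Type := Fin n → Bool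

/-- Morphisms `𝔹ⁿ → 𝔹ᵐ` of the category of Boolean stochastic maps: every input is sent to a
probability distribution on the outputs, so that `f x y` is the probability `f(y | x)`.
(On a finite set every probability mass function is finitely supported.) -/
abbrev BoolStoch (n m : ℕ) : Type := Bits n → PMF (Bits m)

namespace BoolStoch

/-- The first `n` bits of a tuple of `n + m` bits. -/
def fstBits {n m : ℕ} (x : Bits (n + m)) : Bits n := fun i => x (Fin.castAdd m i)

/-- The last `m` bits of a tuple of `n + m` bits. -/
def sndBits {n m : ℕ} (x : Bits (n + m)) : Bits m := fun i => x (Fin.natAdd n i)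

/-- A deterministic map, seen as a stochastic map. -/
noncomputable def ofFun {n m : ℕ} (f : Bits n → Bits m) : BoolStoch n m := fun x => PMF.pure (f x)

/-- Identity: the Dirac distribution at the input. -/
noncomputable def ident (n : ℕ) : BoolStoch n n := ofFun fun x => x

/-- Composition: `(f ; g)(z | x) = ∑ y, f(y | x) * g(z | y)`. -/
noncomputable def comp {n m k : ℕ} (f : BoolStoch n m) (g : BoolStoch m k) : BoolStoch n k :=
  fun x => (f x).bind g

/-- Monoidal product: the product distribution,
`(f ⊗ g)(y, y' | x, x') = f(y | x) * g(y' | x')`. -/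
noncomputable def tensor {n m n' m' : ℕ} (f : BoolStoch n m) (g : BoolStoch n' m') :
    BoolStoch (n + n') (m + m') :=
  fun x => (f (fstBits x)).bind fun y => (g (sndBits x)).bind fun y' =>
    PMF.pure (Fin.append y y')

/-- Symmetry: `(x, y) ↦ (y, x)`. -/
noncomputable def swap (n m : ℕ) : BoolStoch (n + m) (m + n) :=
  ofFun fun x => Fin.append (sndBits x) (fstBits x)

/-- Discarding a bit. -/
noncomputable def discard : BoolStoch 1 0 := ofFun fun _ => ![]

/-- Copying a bit: `a ↦ (a, a)`. -/
noncomputable def copy : BoolStoch 1 2 := ofFun fun x => ![x 0, x 0]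

/-- The if-gate: `(a, 1, b) ↦ a` and `(a, 0, b) ↦ b`. -/
noncomputable def ite : BoolStoch 3 1 := ofFun fun x => ![if x 1 = true then x 0 else x 2]

/-- The distribution of a weighted coin: `1` with probability `p`, `0` with probability `1 - p`. -/
noncomputable def coinPMF (p : unitInterval) : PMF Bool :=
  PMF.ofFintype
    (fun b => if b = true then ENNReal.ofReal (p : ℝ) else ENNReal.ofReal (1 - (p : ℝ)))
    (by
      have h : ENNReal.ofReal (p : ℝ) + ENNReal.ofReal (1 - (p : ℝ)) = 1 := by
        rw [← ENNReal.ofReal_add p.2.1 (sub_nonneg.2 p.2.2)]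
        simp
      simpa using h)

/-- The weighted coin `⟨p⟩`. -/
noncomputable def coin (p : unitInterval) : BoolStoch 0 1 :=
  fun _ => (coinPMF p).map fun b => ![b]

end BoolStoch

/-! ## Diagrams -/

/-- Terms for probabilistic Boolean circuit diagrams. There is one sort `𝔹`, so a type is a word
`𝔹ⁿ`, given by its length `n`. The generators are discard, copy, the if-gate and the weighted
coins `⟨p⟩` with `p ∈ [0, 1]`. -/
inductive Diagram : ℕ → ℕ → Type
  | id (n : ℕ) : Diagram n n
  | swap (n m : ℕ) : Diagram (n + m) (m + n)
  | seq {n m k : ℕ} (f : Diagram n m) (g : Diagram m k) : Diagram n k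
  | par {n m n' m' : ℕ} (f : Diagram n m) (g : Diagram n' m') : Diagram (n + n') (m + m')
  | discard : Diagram 1 0
  | copy : Diagram 1 2
  | ite : Diagram 3 1
  | coin (p : unitInterval) : Diagram 0 1

namespace Diagram

/-- Words of the same length are the same type: transport of a diagram along equalities of its
types (such as `(a + b) + c = a + (b + c)`). -/
def cast {n m n' m' : ℕ} (f : Diagram n m) (hn : n = n' := by omega) (hm : m = m' := by omega) :
    Diagram n' m' :=
  hn ▸ hm ▸ f

/-- Sequential composition, where the target of `f` and the source of `g` are equal, but not
necessarily syntactically so. -/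
def comp {n m m' k : ℕ} (f : Diagram n m) (g : Diagram m' k) (h : m = m' := by omega) :
    Diagram n k :=
  seq f (cast g h.symm rfl)

end Diagram

infixl:60 " ⨾ᵈ " => Diagram.comp
infixl:70 " ⊗ᵈ " => Diagram.par

namespace Diagram

/-- Semantics of diagrams as Boolean stochastic maps. -/
noncomputable def den : {n m : ℕ} → Diagram n m → BoolStoch n m
  | _, _, id n => BoolStoch.ident n
  | _, _, swap n m => BoolStoch.swap n m
  | _, _, seq f g => BoolStoch.comp (den f) (den g)
  | _, _, par f g => BoolStoch.tensor (den f) (den g)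
  | _, _, discard => BoolStoch.discard
  | _, _, copy => BoolStoch.copy
  | _, _, ite => BoolStoch.ite
  | _, _, coin p => BoolStoch.coin p

/-! ### Discard, copy and if-gate on words -/

/-- Copying `A ⊗ C` by copying `A` and copying `C`:
`(copy_A ⊗ copy_C) ; (id_A ⊗ χ_{A,C} ⊗ id_C)`. -/
def copyTensor {n m : ℕ} (f : Diagram n (n + n)) (g : Diagram m (m + m)) :
    Diagram (n + m) ((n + m) + (n + m)) :=
  cast ((f ⊗ᵈ g) ⨾ᵈ (id n ⊗ᵈ swap n m ⊗ᵈ id m))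

/-- The if-gate on `A ⊗ C` from the if-gates on `A` and on `C`: the control bit is copied, and the
wires are permuted from `A C 𝔹 𝔹 A C` through `A 𝔹 C A 𝔹 C` to `A 𝔹 A C 𝔹 C`. -/
def iteTensor {n m : ℕ} (f : Diagram (n + 1 + n) n) (g : Diagram (m + 1 + m) m) :
    Diagram ((n + m) + 1 + (n + m)) (n + m) :=
  id (n + m) ⊗ᵈ copy ⊗ᵈ id (n + m)
    ⨾ᵈ id n ⊗ᵈ swap m 1 ⊗ᵈ swap 1 n ⊗ᵈ id m
    ⨾ᵈ id (n + 1) ⊗ᵈ swap m n ⊗ᵈ id (1 + m)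
    ⨾ᵈ f ⊗ᵈ g

/-- Discard on `𝔹ⁿ`. -/
def discards : (n : ℕ) → Diagram n 0
  | 0 => id 0
  | 1 => discard
  | n + 2 => discards (n + 1) ⊗ᵈ discard

/-- Copy on `𝔹ⁿ`. -/
def copies : (n : ℕ) → Diagram n (n + n)
  | 0 => id 0
  | 1 => copy
  | n + 2 => copyTensor (n := n + 1) (m := 1) (copies (n + 1)) copy

/-- The if-gate `φ` on `𝔹ⁿ`. -/
def ites : (n : ℕ) → Diagram (n + 1 + n) n
  | 0 => discard
  | 1 => ite
  | n + 2 => iteTensor (n := n + 1) (m := 1) (ites (n + 1)) ite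

/-- Probabilistic choice `φᵖ = (id ⊗ ⟨p⟩ ⊗ id) ; φ` on `𝔹ⁿ`. -/
def choice (n : ℕ) (p : unitInterval) : Diagram (n + n) n :=
  id n ⊗ᵈ coin p ⊗ᵈ id n ⨾ᵈ ites n

end Diagram

open Diagram in
/-- Derivable equality of diagrams: the congruence generated by the axioms of strict symmetric
monoidal categories and the axioms of Markov categories with probabilistic choice. -/
inductive Derivable : {n m : ℕ} → Diagram n m → Diagram n m → Prop
  -- equational logic
  | refl {n m : ℕ} (f : Diagram n m) : Derivable f f
  | symm {n m : ℕ} {f g : Diagram n m} : Derivable f g → Derivable g f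
  | trans {n m : ℕ} {f g h : Diagram n m} : Derivable f g → Derivable g h → Derivable f h
  | seq_congr {n m k : ℕ} {f f' : Diagram n m} {g g' : Diagram m k} :
      Derivable f f' → Derivable g g' → Derivable (seq f g) (seq f' g')
  | par_congr {n m n' m' : ℕ} {f f' : Diagram n m} {g g' : Diagram n' m'} :
      Derivable f f' → Derivable g g' → Derivable (f ⊗ᵈ g) (f' ⊗ᵈ g')
  -- strict symmetric monoidal categories
  | seq_assoc {n m k l : ℕ} (f : Diagram n m) (g : Diagram m k) (h : Diagram k l) :
      Derivable (seq (seq f g) h) (seq f (seq g h))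
  | id_seq {n m : ℕ} (f : Diagram n m) : Derivable (seq (id n) f) f
  | seq_id {n m : ℕ} (f : Diagram n m) : Derivable (seq f (id m)) f
  | interchange {n m k n' m' k' : ℕ} (f : Diagram n m) (g : Diagram m k)
      (f' : Diagram n' m') (g' : Diagram m' k') :
      Derivable (seq (f ⊗ᵈ f') (g ⊗ᵈ g')) (seq f g ⊗ᵈ seq f' g')
  | id_par_id (n m : ℕ) : Derivable (id n ⊗ᵈ id m) (id (n + m))
  | unit_par {n m : ℕ} (f : Diagram n m) : Derivable (cast (id 0 ⊗ᵈ f)) f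
  | par_unit {n m : ℕ} (f : Diagram n m) : Derivable (cast (f ⊗ᵈ id 0)) f
  | par_assoc {n m n' m' n'' m'' : ℕ} (f : Diagram n m) (g : Diagram n' m')
      (h : Diagram n'' m'') :
      Derivable (cast ((f ⊗ᵈ g) ⊗ᵈ h)) (f ⊗ᵈ (g ⊗ᵈ h))
  | swap_swap (n m : ℕ) : Derivable (seq (swap n m) (swap m n)) (id (n + m))
  | swap_nat {n m : ℕ} (f : Diagram n m) (k : ℕ) :
      Derivable (seq (f ⊗ᵈ id k) (swap m k)) (seq (swap n k) (id k ⊗ᵈ f))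
  | swap_par (n m k : ℕ) :
      Derivable (cast (swap (n + m) k)) (id n ⊗ᵈ swap m k ⨾ᵈ swap n k ⊗ᵈ id m)
  -- cocommutative comonoids, naturality of discard, coherence with the monoidal structure
  | copy_assoc (n : ℕ) :
      Derivable (copies n ⨾ᵈ copies n ⊗ᵈ id n) (cast (copies n ⨾ᵈ id n ⊗ᵈ copies n))
  | copy_unit (n : ℕ) : Derivable (cast (copies n ⨾ᵈ discards n ⊗ᵈ id n)) (id n)
  | copy_comm (n : ℕ) : Derivable (copies n ⨾ᵈ swap n n) (copies n)
  | discard_nat {n m : ℕ} (f : Diagram n m) : Derivable (f ⨾ᵈ discards m) (discards n)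
  | discard_par (n m : ℕ) : Derivable (discards (n + m)) (discards n ⊗ᵈ discards m)
  | copy_par (n m : ℕ) : Derivable (copies (n + m)) (copyTensor (copies n) (copies m))
  -- probabilistic choice
  | one_det : Derivable (coin 1 ⨾ᵈ copy) (coin 1 ⊗ᵈ coin 1)
  | zero_det : Derivable (coin 0 ⨾ᵈ copy) (coin 0 ⊗ᵈ coin 0)
  | ite_bool : Derivable (cast (coin 1 ⊗ᵈ id 1 ⊗ᵈ coin 0 ⨾ᵈ ite)) (id 1)
  | ite_one (n : ℕ) : Derivable (choice n 1) (id n ⊗ᵈ discards n)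
  | ite_assoc (n : ℕ) (p q r t : unitInterval) (ht : (p : ℝ) * q = t)
      (hr : (1 - (r : ℝ)) * (1 - t) = 1 - q) :
      Derivable (choice n p ⊗ᵈ id n ⨾ᵈ choice n q)
        (cast (id n ⊗ᵈ choice n r ⨾ᵈ choice n t))
  | ite_idem (n : ℕ) :
      Derivable (copies n ⊗ᵈ id 1 ⨾ᵈ id n ⊗ᵈ swap n 1 ⨾ᵈ ites n) (id n ⊗ᵈ discard)
  | ite_comm (n : ℕ) (p : unitInterval) :
      Derivable (choice n p) (swap n n ⨾ᵈ choice n (unitInterval.symm p))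
  | ite_unit : Derivable (ites 0) discard
  | ite_par (n m : ℕ) : Derivable (ites (n + m)) (iteTensor (ites n) (ites m))
  | ite_nat {n m : ℕ} (f : Diagram n m) :
      Derivable (ites n ⨾ᵈ f) (f ⊗ᵈ id 1 ⊗ᵈ f ⨾ᵈ ites m)

/-! ## Diagrams up to derivable equality -/

/-! Soundness is a rule induction. For completeness, circuits are taken modulo derivable equality,
so that a derivation becomes a chain of rewrites, and two facts are combined. First, a circuit is
determined by its values at points (`ext_point`). Feeding `(y, 1)`, `x`, `(y, 0)` to the if-gate on
words returns `(y, x)` (`fork_comp_ites`): the gate splits along the tensor, is idempotent on `y`,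
and returns `x` from `(1, x, 0)`. Precomposing a circuit with this identity and using naturality of
the if-gate gives a Shannon expansion in the last input (`eq_fork_comp_ites`), and induction on the
number of inputs finishes. Second, a state is determined by its distribution
(`IsState.eq_of_dist_eq`). The choice axioms make states a convex algebra under `mix`, and
postcomposition is affine by naturality, so every state is an iterated convex combination of points
(`isConvex_of_isState`). Regrouping such a combination by its first bit gives `s = p (1 ⊗ s₁) + (1 -
p) (0 ⊗ s₀)` (`IsState.exists_eq_mix`). The distribution of `s` determines `p` and those of `s₁`,
`s₀` whose weight is nonzero; a branch of weight zero is removed by `mix_zero` or `mix_one`.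
Induction on the number of bits concludes. -/

namespace Diagram

/-- The state of `k` zero bits. -/
def zeros : (k : ℕ) → Diagram 0 k
  | 0 => id 0
  | k + 1 => zeros k ⊗ᵈ coin 0

/-- Derivable equality of diagrams, where the types are equal but not necessarily syntactically
so. -/
inductive HDerivable : (Σ n m, Diagram n m) → (Σ n m, Diagram n m) → Prop
  | intro {n m : ℕ} {f g : Diagram n m} : Derivable f g → HDerivable ⟨n, m, f⟩ ⟨n, m, g⟩

instance setoid : Setoid (Σ n m, Diagram n m) where
  r := HDerivable
  iseqv :=
    { refl := fun _ => ⟨.refl _⟩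
      symm := by
        rintro _ _ ⟨h⟩
        exact ⟨h.symm⟩
      trans := by
        rintro _ _ _ ⟨h⟩ ⟨h'⟩
        exact ⟨h.trans h'⟩ }

end Diagram

/-- Diagrams up to derivable equality. The arities are not part of the type, so that the monoidal
product is strictly associative. -/
def Circuit : Type := Quotient Diagram.setoid

namespace Circuit

open Diagram (HDerivable)

/-- The class of a diagram. -/
def mk {n m : ℕ} (f : Diagram n m) : Circuit := Quotient.mk _ ⟨n, m, f⟩

theorem ind {P : Circuit → Prop} (h : ∀ {n m : ℕ} (f : Diagram n m), P (mk f)) (a : Circuit) :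
    P a :=
  Quotient.inductionOn a fun ⟨_, _, f⟩ => h f

/-- Erasing the arities loses nothing, since `HDerivable` only relates diagrams of the same type. -/
theorem mk_eq_mk {n m : ℕ} {f g : Diagram n m} : mk f = mk g ↔ Derivable f g := by
  refine ⟨fun h => ?_, fun h => Quotient.sound (HDerivable.intro h)⟩
  obtain ⟨h⟩ : HDerivable _ _ := Quotient.exact h
  exact h

@[simp]
theorem mk_cast {n m n' m' : ℕ} (f : Diagram n m) (hn : n = n') (hm : m = m') :
    mk (f.cast hn hm) = mk f := by
  subst hn hm
  rfl

/-- The number of inputs. -/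
def dom (a : Circuit) : ℕ :=
  Quotient.lift (fun f : Σ n m, Diagram n m => f.1) (by rintro _ _ ⟨_⟩; rfl) a

/-- The number of outputs. -/
def cod (a : Circuit) : ℕ :=
  Quotient.lift (fun f : Σ n m, Diagram n m => f.2.1) (by rintro _ _ ⟨_⟩; rfl) a

@[simp] theorem dom_mk {n m : ℕ} (f : Diagram n m) : (mk f).dom = n := rfl
@[simp] theorem cod_mk {n m : ℕ} (f : Diagram n m) : (mk f).cod = m := rfl

theorem exists_rep {a : Circuit} {n m : ℕ} (hn : a.dom = n) (hm : a.cod = m) :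
    ∃ f : Diagram n m, mk f = a := by
  induction a using ind with | _ f => ?_
  simp only [dom_mk, cod_mk] at hn hm
  subst hn hm
  exact ⟨f, rfl⟩

/-- Sequential composition; the value is irrelevant unless the arities match. -/
def comp : Circuit → Circuit → Circuit :=
  Quotient.map₂
    (fun f g => if h : f.2.1 = g.1 then ⟨_, _, f.2.2.comp g.2.2 h⟩
        -- The junk value has the domain of `f` and the codomain of `g`, so `dom_comp` and
        -- `cod_comp` need no hypothesis.
        else ⟨_, _, .seq (.discards f.1) (.zeros g.2.1)⟩)
    (by
      rintro _ _ @⟨n, m, f, f', hf⟩ _ _ @⟨k, l, g, g', hg⟩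
      by_cases h : m = k
      · subst h
        simp only [dif_pos]
        exact HDerivable.intro (.seq_congr hf hg)
      · simp only [dif_neg h]
        exact Setoid.refl _)

/-- Parallel composition. -/
def par : Circuit → Circuit → Circuit :=
  Quotient.map₂ (fun f g => ⟨_, _, f.2.2.par g.2.2⟩)
    (by
      rintro _ _ ⟨hf⟩ _ _ ⟨hg⟩
      exact HDerivable.intro (.par_congr hf hg))

infixl:65 " ⨟ " => Circuit.comp

/-- The identity circuit. -/
def ident (n : ℕ) : Circuit := mk (.id n)

/-- The symmetry. -/
def swap (n m : ℕ) : Circuit := mk (.swap n m)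

/-- Copying a word. -/
def copies (n : ℕ) : Circuit := mk (.copies n)

/-- Discarding a word. -/
def discards (n : ℕ) : Circuit := mk (.discards n)

/-- The if-gate on words. -/
def ites (n : ℕ) : Circuit := mk (.ites n)

/-- The weighted coin. -/
def coin (p : unitInterval) : Circuit := mk (.coin p)

instance : Mul Circuit := ⟨par⟩
instance : One Circuit := ⟨ident 0⟩

theorem mk_par {n m n' m' : ℕ} (f : Diagram n m) (g : Diagram n' m') :
    mk (f ⊗ᵈ g) = mk f * mk g := rfl

theorem mk_comp {n m m' k : ℕ} (f : Diagram n m) (g : Diagram m' k) (h : m = m') :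
    mk (f.comp g h) = mk f ⨟ mk g := by
  subst h
  simp [comp, mk]
  rfl

theorem mk_seq {n m k : ℕ} (f : Diagram n m) (g : Diagram m k) :
    mk (f.seq g) = mk f ⨟ mk g :=
  mk_comp f g rfl

theorem one_eq : (1 : Circuit) = ident 0 := rfl
theorem mk_id (n : ℕ) : mk (.id n) = ident n := rfl
theorem mk_swap (n m : ℕ) : mk (.swap n m) = swap n m := rfl
theorem mk_copies (n : ℕ) : mk (.copies n) = copies n := rfl
theorem mk_discards (n : ℕ) : mk (.discards n) = discards n := rfl
theorem mk_ites (n : ℕ) : mk (.ites n) = ites n := rfl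
theorem mk_coin (p : unitInterval) : mk (.coin p) = coin p := rfl
theorem mk_discard : mk .discard = discards 1 := rfl
theorem mk_copy : mk .copy = copies 1 := rfl
theorem mk_ite : mk .ite = ites 1 := rfl

instance : Monoid Circuit where
  mul_assoc a b c := by
    induction a using ind with | _ f => ?_
    induction b using ind with | _ g => ?_
    induction c using ind with | _ h => ?_
    simpa only [mk_cast, mk_par] using mk_eq_mk.2 (Derivable.par_assoc f g h)
  one_mul a := by
    induction a using ind with | _ f => ?_
    simpa only [one_eq, mk_cast, mk_par, mk_id] using mk_eq_mk.2 (Derivable.unit_par f)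
  mul_one a := by
    induction a using ind with | _ f => ?_
    simpa only [one_eq, mk_cast, mk_par, mk_id] using mk_eq_mk.2 (Derivable.par_unit f)

@[simp] theorem dom_mul (a b : Circuit) : (a * b).dom = a.dom + b.dom := by
  induction a using ind with | _ f => ?_
  induction b using ind with | _ g => ?_
  rfl

@[simp] theorem cod_mul (a b : Circuit) : (a * b).cod = a.cod + b.cod := by
  induction a using ind with | _ f => ?_
  induction b using ind with | _ g => ?_
  rfl

@[simp] theorem dom_comp (a b : Circuit) : (a ⨟ b).dom = a.dom := by
  induction a using ind with | @h n m f => ?_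
  induction b using ind with | @h n' m' g => ?_
  by_cases h : m = n'
  · rw [← mk_comp f g h, dom_mk, dom_mk]
  · simp only [comp, mk, Quotient.map₂_mk, dif_neg h]
    rfl

@[simp] theorem cod_comp (a b : Circuit) : (a ⨟ b).cod = b.cod := by
  induction a using ind with | @h n m f => ?_
  induction b using ind with | @h n' m' g => ?_
  by_cases h : m = n'
  · rw [← mk_comp f g h, cod_mk, cod_mk]
  · simp only [comp, mk, Quotient.map₂_mk, dif_neg h]
    rfl

@[simp] theorem dom_ident (n : ℕ) : (ident n).dom = n := rfl
@[simp] theorem cod_ident (n : ℕ) : (ident n).cod = n := rfl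
@[simp] theorem dom_swap (n m : ℕ) : (swap n m).dom = n + m := rfl
@[simp] theorem cod_swap (n m : ℕ) : (swap n m).cod = m + n := rfl
@[simp] theorem dom_copies (n : ℕ) : (copies n).dom = n := rfl
@[simp] theorem cod_copies (n : ℕ) : (copies n).cod = n + n := rfl
@[simp] theorem dom_discards (n : ℕ) : (discards n).dom = n := rfl
@[simp] theorem cod_discards (n : ℕ) : (discards n).cod = 0 := rfl
@[simp] theorem dom_ites (n : ℕ) : (ites n).dom = n + 1 + n := rfl
@[simp] theorem cod_ites (n : ℕ) : (ites n).cod = n := rfl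
@[simp] theorem dom_coin (p : unitInterval) : (coin p).dom = 0 := rfl
@[simp] theorem cod_coin (p : unitInterval) : (coin p).cod = 1 := rfl
@[simp] theorem dom_one : (1 : Circuit).dom = 0 := rfl
@[simp] theorem cod_one : (1 : Circuit).cod = 0 := rfl

attribute [grind =] dom_mul cod_mul dom_comp cod_comp dom_ident cod_ident dom_swap cod_swap
  dom_copies cod_copies dom_discards cod_discards dom_ites cod_ites dom_coin cod_coin dom_one
  cod_one

/-! ### The axioms as equations between circuits -/

theorem comp_assoc {a b c : Circuit} (h : a.cod = b.dom) (h' : b.cod = c.dom) :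
    a ⨟ b ⨟ c = a ⨟ (b ⨟ c) := by
  induction a using ind with | @h n m f => ?_
  induction b using ind with | @h n' m' g => ?_
  induction c using ind with | @h n'' m'' k => ?_
  simp only [dom_mk, cod_mk] at h h'
  subst h h'
  simpa only [mk_seq] using mk_eq_mk.2 (Derivable.seq_assoc f g k)

theorem ident_comp {a : Circuit} {n : ℕ} (h : a.dom = n) : ident n ⨟ a = a := by
  subst h
  induction a using ind with | _ f => ?_
  simpa only [dom_mk, mk_seq, mk_id] using mk_eq_mk.2 (Derivable.id_seq f)

theorem comp_ident {a : Circuit} {n : ℕ} (h : a.cod = n) : a ⨟ ident n = a := by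
  subst h
  induction a using ind with | _ f => ?_
  simpa only [cod_mk, mk_seq, mk_id] using mk_eq_mk.2 (Derivable.seq_id f)

theorem mul_comp_mul {a b c d : Circuit} (h : a.cod = c.dom) (h' : b.cod = d.dom) :
    a * b ⨟ c * d = (a ⨟ c) * (b ⨟ d) := by
  induction a using ind with | @h n m f => ?_
  induction b using ind with | @h n' m' f' => ?_
  induction c using ind with | @h k l g => ?_
  induction d using ind with | @h k' l' g' => ?_
  simp only [dom_mk, cod_mk] at h h'
  subst h h'
  simpa only [mk_seq, mk_par] using mk_eq_mk.2 (Derivable.interchange f g f' g')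

theorem ident_mul_ident (n m : ℕ) : ident n * ident m = ident (n + m) :=
  mk_eq_mk.2 (Derivable.id_par_id n m)

theorem swap_comp_swap (n m : ℕ) : swap n m ⨟ swap m n = ident (n + m) := by
  simpa only [mk_seq, mk_swap, mk_id] using mk_eq_mk.2 (Derivable.swap_swap n m)

theorem mul_ident_comp_swap (a : Circuit) (k : ℕ) :
    a * ident k ⨟ swap a.cod k = swap a.dom k ⨟ ident k * a := by
  induction a using ind with | _ f => ?_
  simpa only [cod_mk, dom_mk, mk_seq, mk_par, mk_id, mk_swap] using
    mk_eq_mk.2 (Derivable.swap_nat f k)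

theorem swap_add (n m k : ℕ) :
    swap (n + m) k = ident n * swap m k ⨟ swap n k * ident m := by
  simpa only [mk_cast, mk_swap, mk_comp, mk_par, mk_id] using mk_eq_mk.2 (Derivable.swap_par n m k)

theorem comp_discards (a : Circuit) : a ⨟ discards a.cod = discards a.dom := by
  induction a using ind with | _ f => ?_
  simpa only [cod_mk, dom_mk, mk_comp, mk_discards] using mk_eq_mk.2 (Derivable.discard_nat f)

theorem copies_comp_discards_mul (n : ℕ) : copies n ⨟ discards n * ident n = ident n := by
  simpa only [mk_cast, mk_comp, mk_copies, mk_par, mk_discards, mk_id] using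
    mk_eq_mk.2 (Derivable.copy_unit n)

theorem coin_one_comp_copies : coin 1 ⨟ copies 1 = coin 1 * coin 1 := by
  simpa only [mk_comp, mk_coin, mk_copy, mk_par] using mk_eq_mk.2 Derivable.one_det

theorem coin_zero_comp_copies : coin 0 ⨟ copies 1 = coin 0 * coin 0 := by
  simpa only [mk_comp, mk_coin, mk_copy, mk_par] using mk_eq_mk.2 Derivable.zero_det

theorem coin_mul_ident_mul_coin_comp_ites :
    coin 1 * ident 1 * coin 0 ⨟ ites 1 = ident 1 := by
  simpa only [mk_cast, mk_comp, mk_par, mk_coin, mk_id, mk_ite] using mk_eq_mk.2 Derivable.ite_bool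

/-- Probabilistic choice on words. -/
def choice (n : ℕ) (p : unitInterval) : Circuit := ident n * coin p * ident n ⨟ ites n

theorem mk_choice (n : ℕ) (p : unitInterval) : mk (.choice n p) = choice n p := by
  simp only [Diagram.choice, choice]
  exact mk_comp _ _ _

@[simp] theorem dom_choice (n : ℕ) (p : unitInterval) : (choice n p).dom = n + n := by
  rw [← mk_choice, dom_mk]

@[simp] theorem cod_choice (n : ℕ) (p : unitInterval) : (choice n p).cod = n := by
  rw [← mk_choice, cod_mk]

attribute [grind =] dom_choice cod_choice

theorem choice_one (n : ℕ) : choice n 1 = ident n * discards n := by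
  simpa only [mk_choice, mk_par, mk_id, mk_discards] using mk_eq_mk.2 (Derivable.ite_one n)

theorem choice_comm (n : ℕ) (p : unitInterval) :
    choice n p = swap n n ⨟ choice n (unitInterval.symm p) := by
  simpa only [mk_choice, mk_comp, mk_swap] using mk_eq_mk.2 (Derivable.ite_comm n p)

theorem choice_assoc (n : ℕ) {p q r t : unitInterval} (ht : (p : ℝ) * q = t)
    (hr : (1 - (r : ℝ)) * (1 - t) = 1 - q) :
    choice n p * ident n ⨟ choice n q = ident n * choice n r ⨟ choice n t := by
  simpa only [mk_comp, mk_par, mk_choice, mk_id, mk_cast] using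
    mk_eq_mk.2 (Derivable.ite_assoc n p q r t ht hr)

theorem copies_comp_ites (n : ℕ) :
    copies n * ident 1 ⨟ ident n * swap n 1 ⨟ ites n = ident n * discards 1 := by
  simpa only [mk_comp, mk_par, mk_copies, mk_id, mk_swap, mk_ites, mk_discard] using
    mk_eq_mk.2 (Derivable.ite_idem n)

theorem ites_add (n m : ℕ) :
    ites (n + m) = ident (n + m) * copies 1 * ident (n + m)
      ⨟ ident n * swap m 1 * swap 1 n * ident m
      ⨟ ident (n + 1) * swap m n * ident (1 + m)
      ⨟ ites n * ites m := by
  simpa only [mk_ites, Diagram.iteTensor, mk_comp, mk_par, mk_id, mk_copy, mk_swap] using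
    mk_eq_mk.2 (Derivable.ite_par n m)

theorem ites_comp (a : Circuit) : ites a.dom ⨟ a = a * ident 1 * a ⨟ ites a.cod := by
  induction a using ind with | _ f => ?_
  simpa only [dom_mk, cod_mk, mk_comp, mk_ites, mk_par, mk_id] using
    mk_eq_mk.2 (Derivable.ite_nat f)

end Circuit

namespace Circuit

/-! ### Consequences of the axioms of symmetric monoidal categories -/

/-- Naturality of discard makes `𝔹⁰` terminal. -/
theorem eq_one {a : Circuit} (h : a.dom = 0) (h' : a.cod = 0) : a = 1 := by
  have := comp_discards a
  rw [h, h'] at this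
  rwa [show discards 0 = ident 0 from rfl, comp_ident h', ← one_eq] at this

theorem mul_ident_comp_ident_mul {a b : Circuit} {n m : ℕ} (hn : b.dom = n) (hm : a.cod = m) :
    a * ident n ⨟ ident m * b = a * b := by
  rw [mul_comp_mul (by simpa) (by simpa using hn.symm), comp_ident hm, ident_comp hn]

theorem ident_mul_comp_mul_ident {a b : Circuit} {n m : ℕ} (hn : a.dom = n) (hm : b.cod = m) :
    ident n * b ⨟ a * ident m = a * b := by
  rw [mul_comp_mul (by simpa using hn.symm) (by simpa), comp_ident hm, ident_comp hn]

/-- The hexagon with `0 + 0 = 0` makes this symmetry idempotent, and it is invertible. -/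
theorem swap_zero_left (n : ℕ) : swap 0 n = ident n := by
  have h : swap 0 n = swap 0 n ⨟ swap 0 n := by
    simpa [← one_eq] using swap_add 0 0 n
  calc swap 0 n = swap 0 n ⨟ (swap 0 n ⨟ swap n 0) := by
        rw [swap_comp_swap, comp_ident (by grind)]
    _ = ident n := by
        rw [← comp_assoc (by grind) (by grind), ← h, swap_comp_swap, zero_add]

theorem ident_mul_comp_swap (a : Circuit) (k : ℕ) :
    ident k * a ⨟ swap k a.cod = swap k a.dom ⨟ a * ident k := by
  calc ident k * a ⨟ swap k a.cod
      = swap k a.dom ⨟ swap a.dom k ⨟ (ident k * a ⨟ swap k a.cod) := by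
        rw [swap_comp_swap, ident_comp (by grind)]
    _ = swap k a.dom ⨟ (swap a.dom k ⨟ ident k * a ⨟ swap k a.cod) := by
        rw [comp_assoc (by grind) (by grind), comp_assoc (by grind) (by grind)]
    _ = swap k a.dom ⨟ a * ident k := by
        rw [← mul_ident_comp_swap, comp_assoc (by grind) (by grind), swap_comp_swap,
          comp_ident (by grind)]

theorem state_mul_ident_comp_swap {s : Circuit} {k : ℕ} (hs : s.dom = 0) (hk : s.cod = k) (n : ℕ) :
    s * ident n ⨟ swap k n = ident n * s := by
  rw [← hk, mul_ident_comp_swap, hs, swap_zero_left, ident_comp (by simp [hs])]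

theorem state_mul_state_comp_swap {s t : Circuit} {n m : ℕ} (hs : s.dom = 0) (_ht : t.dom = 0)
    (hn : s.cod = n) (hm : t.cod = m) : s * t ⨟ swap n m = t * s := by
  rw [← ident_mul_comp_mul_ident hs hm, ← one_eq, one_mul,
    comp_assoc (by simp [hs, hm]) (by simp [hn]), state_mul_ident_comp_swap hs hn,
    ← mul_ident_comp_ident_mul hs hm, ← one_eq, mul_one]

theorem swap_comp_ident_mul_swap (n : ℕ) :
    swap n 2 ⨟ ident 1 * swap 1 n = swap n 1 * ident 1 := by
  have h : swap 2 n ⨟ swap n 1 * ident 1 = ident 1 * swap 1 n := by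
    rw [swap_add 1 1 n, comp_assoc (by grind) (by grind), mul_comp_mul (by grind) (by grind),
      swap_comp_swap, ident_comp (by grind), ident_mul_ident, comp_ident (by grind)]
  rw [← h, ← comp_assoc (by grind) (by grind), swap_comp_swap, ident_comp (by grind)]

theorem swap_comp_copies_mul (n : ℕ) :
    swap n 1 ⨟ copies 1 * ident n ⨟ ident 1 * swap 1 n =
      ident n * copies 1 ⨟ swap n 1 * ident 1 := by
  have h := ident_mul_comp_swap (copies 1) n
  simp only [cod_copies, dom_copies] at h
  rw [← h, comp_assoc (by grind) (by grind), swap_comp_ident_mul_swap]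

/-! ### Case distinction on a bit -/

/-- The circuit `(y, x) ↦ (y, x, y)`. -/
def fork (n : ℕ) : Circuit := copies n * ident 1 ⨟ ident n * swap n 1

@[simp, grind =] theorem dom_fork (n : ℕ) : (fork n).dom = n + 1 := by
  simp [fork]

@[simp, grind =] theorem cod_fork (n : ℕ) : (fork n).cod = n + 1 + n := by
  grind [fork]

theorem comp_state_mul_ident {s b : Circuit} {m : ℕ} (hs : s.dom = 0) (hm : b.cod = m) :
    b ⨟ s * ident m = s * b := by
  rw [← ident_mul_comp_mul_ident hs hm, ← one_eq, one_mul]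

theorem comp_ident_mul_state {s b : Circuit} {m : ℕ} (hs : s.dom = 0) (hm : b.cod = m) :
    b ⨟ ident m * s = b * s := by
  rw [← mul_ident_comp_ident_mul hs hm, ← one_eq, mul_one]

/-- A state slides freely past wires. These swaps are the rewiring in `ites_add n 1` without its
outermost wires; they carry the coin to the position just before the last wire. -/
theorem coin_mul_copies_comp_swaps (n : ℕ) (p : unitInterval) :
    coin p * copies 1 * ident n ⨟ swap 1 1 * swap 1 n ⨟ ident 1 * swap 1 n * ident 1 =
      copies 1 * ident n ⨟ ident 1 * swap 1 n ⨟ ident 1 * ident n * coin p * ident 1 := by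
  have h1 : coin p * copies 1 * ident n ⨟ swap 1 1 * swap 1 n =
      copies 1 * ident n ⨟ ident 1 * coin p * swap 1 n := by
    calc _ = copies 1 * ident n ⨟ coin p * ident 1 * (ident 1 * ident n) ⨟ swap 1 1 * swap 1 n := by
          simp only [ident_mul_ident, mul_assoc]
          rw [comp_state_mul_ident (by grind) (by grind)]
      _ = copies 1 * ident n ⨟ ((coin p * ident 1 ⨟ swap 1 1) *
            (ident 1 * ident n ⨟ swap 1 n)) := by
          rw [comp_assoc (by grind) (by grind), mul_comp_mul (by grind) (by grind)]
      _ = _ := by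
          rw [state_mul_ident_comp_swap (by grind) (by grind), ident_mul_ident,
            ident_comp (by grind)]
  have h2 : ident 1 * coin p * swap 1 n ⨟ ident 1 * swap 1 n * ident 1 =
      ident 1 * swap 1 n ⨟ ident 1 * ident n * coin p * ident 1 := by
    calc _ = ident 1 * (swap 1 n ⨟ coin p * ident (n + 1)) ⨟ ident 1 * (swap 1 n * ident 1) := by
          rw [comp_state_mul_ident (s := coin p) (by grind) (by grind), mul_assoc, mul_assoc]
      _ = ident 1 * (swap 1 n ⨟ (coin p * ident n * ident 1 ⨟ swap 1 n * ident 1)) := by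
          rw [mul_comp_mul (by grind) (by grind), ident_comp (by grind),
            comp_assoc (by grind) (by grind), mul_assoc, ident_mul_ident]
      _ = ident 1 * (swap 1 n ⨟ ident n * coin p * ident 1) := by
          rw [mul_comp_mul (by grind) (by grind), ident_comp (by grind),
            state_mul_ident_comp_swap (by grind) (by grind)]
      _ = _ := by
          simp only [mul_assoc]
          rw [mul_comp_mul (by grind) (by grind), ident_comp (by grind)]
  rw [h1, comp_assoc (by grind) (by grind), h2, ← comp_assoc (by grind) (by grind)]

/-- Both sides are the rewiring `(y, x) ↦ (y, x, y, x)`. -/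
theorem fork_comp_ident_mul_copies (n : ℕ) :
    fork n ⨟ ident n * (copies 1 * ident n ⨟ ident 1 * swap 1 n) =
      ident n * copies 1 ⨟ fork n * ident 1 := by
  calc _ = copies n * ident 1 ⨟
        ident n * (swap n 1 ⨟ copies 1 * ident n ⨟ ident 1 * swap 1 n) := by
        rw [fork, comp_assoc (by grind) (by grind), mul_comp_mul (by grind) (by grind),
          ← comp_assoc (by grind) (by grind), ident_comp (by grind)]
    _ = copies n * ident 1 ⨟ (ident (n + n) * copies 1 ⨟ ident n * (swap n 1 * ident 1)) := by
        rw [swap_comp_copies_mul, ← ident_mul_ident, mul_assoc (ident n) (ident n),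
          mul_comp_mul (a := ident n) (c := ident n) (by grind) (by grind),
          ident_comp (a := ident n) (by grind)]
    _ = ident n * copies 1 ⨟ copies n * ident 2 ⨟ ident n * swap n 1 * ident 1 := by
        rw [← comp_assoc (by grind) (by grind), mul_ident_comp_ident_mul (by grind) (by grind),
          ident_mul_comp_mul_ident (by grind) (by grind), mul_assoc]
    _ = ident n * copies 1 ⨟ (copies n * ident 1 * ident 1 ⨟ ident n * swap n 1 * ident 1) := by
        rw [comp_assoc (by grind) (by grind), mul_assoc (copies n), ident_mul_ident]
    _ = _ := by
        rw [fork, mul_comp_mul (a := copies n * ident 1) (by grind) (by grind),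
          ident_comp (a := ident 1) (by grind)]

/-- When `ites (n + 1)` is unfolded by `ites_add`, the word `(y, 1), x, (y, 0)` is rewired to `(y,
x, y)` for the gate on `n` bits and `(1, x, 0)` for the gate on one bit. -/
theorem fork_comp_coins (n : ℕ) :
    fork n ⨟ ident n * coin 1 * ident 1 * (ident n * coin 0)
        ⨟ (ident (n + 1) * copies 1 * ident (n + 1) ⨟ ident n * swap 1 1 * swap 1 n * ident 1
        ⨟ ident (n + 1) * swap 1 n * ident (1 + 1)) =
      ident n * copies 1 ⨟ fork n * (coin 1 * ident 1 * coin 0) := by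
  have h1 : ident n * coin 1 * ident 1 * (ident n * coin 0) ⨟
      ident (n + 1) * copies 1 * ident (n + 1) =
      ident n * (coin 1 * copies 1 * ident n) * coin 0 := by
    simp only [← ident_mul_ident, mul_assoc]
    simp (disch := grind) only [mul_comp_mul, ident_comp, comp_ident]
  have h2 : ident n * (coin 1 * copies 1 * ident n) * coin 0
        ⨟ ident n * swap 1 1 * swap 1 n * ident 1
        ⨟ ident (n + 1) * swap 1 n * ident (1 + 1) =
      ident n * (coin 1 * copies 1 * ident n ⨟ swap 1 1 * swap 1 n
        ⨟ ident 1 * swap 1 n * ident 1) * coin 0 := by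
    rw [show ident n * swap 1 1 * swap 1 n * ident 1 = ident n * (swap 1 1 * swap 1 n) * ident 1 by
        simp only [mul_assoc],
      show ident (n + 1) * swap 1 n * ident (1 + 1) =
        ident n * (ident 1 * swap 1 n * ident 1) * ident 1 by
        simp only [mul_assoc, ← ident_mul_ident]]
    simp (disch := grind) only [mul_comp_mul, comp_ident]
  calc _ = fork n ⨟ ident n * (copies 1 * ident n ⨟ ident 1 * swap 1 n
        ⨟ ident 1 * ident n * coin 1 * ident 1) * coin 0 := by
        rw [comp_assoc (by grind) (by grind), ← coin_mul_copies_comp_swaps, ← h2, ← h1,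
          comp_assoc (a := ident n * coin 1 * ident 1 * (ident n * coin 0)) (by grind) (by grind),
          comp_assoc (a := ident n * coin 1 * ident 1 * (ident n * coin 0)) (by grind) (by grind)]
    _ = fork n ⨟ (ident n * (copies 1 * ident n ⨟ ident 1 * swap 1 n)
        ⨟ ident n * (ident 1 * ident n * coin 1 * ident 1) * coin 0) := by
        rw [← mul_one (ident n * (copies 1 * ident n ⨟ ident 1 * swap 1 n))]
        simp (disch := grind) only [mul_comp_mul, ident_comp, one_eq]
    _ = ident n * copies 1 ⨟ fork n * ident 1
        ⨟ ident (n + 1 + n) * (coin 1 * ident 1 * coin 0) := by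
        rw [← comp_assoc (by grind) (by grind), fork_comp_ident_mul_copies]
        simp only [← ident_mul_ident, mul_assoc]
    _ = _ := by
        rw [comp_assoc (by grind) (by grind), mul_comp_mul (by grind) (by grind),
          comp_ident (by grind), ident_comp (by grind)]

/-- "If `x` then `(y, 1)` else `(y, 0)`" is `(y, x)`: idempotence collapses the first `n` bits,
discarding one copy of `x`, and the axiom on `(1, x, 0)` returns the other copy. -/
theorem fork_comp_ites (n : ℕ) :
    fork n ⨟ ident n * coin 1 * ident 1 * (ident n * coin 0) ⨟ ites (n + 1) = ident (n + 1) := by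
  rw [ites_add n 1, ← comp_assoc (by grind) (by grind), fork_comp_coins,
    comp_assoc (by grind) (by grind), mul_comp_mul (by grind) (by grind),
    coin_mul_ident_mul_coin_comp_ites]
  rw [show fork n ⨟ ites n = ident n * discards 1 from copies_comp_ites n, mul_assoc,
    mul_comp_mul (by grind) (by grind), copies_comp_discards_mul, ident_comp (by grind),
    ident_mul_ident]

/-- A circuit is determined by its values at `1` and `0` of the last input. -/
theorem eq_fork_comp_ites {a : Circuit} {n : ℕ} (h : a.dom = n + 1) :
    a = fork n ⨟ (ident n * coin 1 ⨟ a) * ident 1 * (ident n * coin 0 ⨟ a) ⨟ ites a.cod := by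
  -- The identity is expanded before `a`; naturality of the if-gate then pushes `a` into both
  -- branches.
  calc a = fork n ⨟ ident n * coin 1 * ident 1 * (ident n * coin 0) ⨟ (ites a.dom ⨟ a) := by
        rw [h, ← comp_assoc (by grind) (by grind), fork_comp_ites, ident_comp h]
    _ = _ := by
        rw [ites_comp, ← comp_assoc (by grind) (by grind),
          comp_assoc (a := fork n) (by grind) (by grind),
          mul_comp_mul (by grind) (by grind), mul_comp_mul (by grind) (by grind),
          ident_comp (a := ident 1) (by grind)]

theorem ext_last {a b : Circuit} {n : ℕ} (ha : a.dom = n + 1) (hb : b.dom = n + 1)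
    (hc : a.cod = b.cod) (h1 : ident n * coin 1 ⨟ a = ident n * coin 1 ⨟ b)
    (h0 : ident n * coin 0 ⨟ a = ident n * coin 0 ⨟ b) : a = b := by
  rw [eq_fork_comp_ites ha, eq_fork_comp_ites hb, h1, h0, hc]

end Circuit

namespace Circuit

/-! ### Convex combinations of states -/

/-- The convex combination of two states. -/
def mix (p : unitInterval) (s t : Circuit) : Circuit := s * coin p * t ⨟ ites s.cod

@[simp, grind =] theorem dom_mix (p : unitInterval) (s t : Circuit) :
    (mix p s t).dom = s.dom + t.dom := by
  simp [mix]

@[simp, grind =] theorem cod_mix (p : unitInterval) (s t : Circuit) :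
    (mix p s t).cod = s.cod := by
  simp [mix]

/-- A circuit without inputs and with `m` outputs. -/
structure IsState (m : ℕ) (s : Circuit) : Prop where
  dom_eq : s.dom = 0
  cod_eq : s.cod = m

attribute [grind →] IsState.dom_eq IsState.cod_eq

variable {m n : ℕ} {s t u : Circuit}

theorem IsState.mul (hs : IsState n s) (ht : IsState m t) : IsState (n + m) (s * t) :=
  ⟨by grind, by grind⟩

theorem IsState.mix (hs : IsState m s) (ht : IsState m t) (p : unitInterval) :
    IsState m (mix p s t) :=
  ⟨by grind, by grind⟩

theorem IsState.comp (hs : IsState m s) {a : Circuit} (ha : a.cod = n) : IsState n (s ⨟ a) :=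
  ⟨by grind, by grind⟩

/-- This form transfers the axioms on `choice` to `mix`. -/
theorem mix_eq_mul_comp_choice (hs : IsState m s) (ht : IsState m t) (p : unitInterval) :
    mix p s t = s * t ⨟ choice m p := by
  have h : s * t ⨟ ident m * coin p * ident m = s * coin p * t := by
    rw [mul_comp_mul (by grind) (by grind), comp_ident_mul_state (by grind) (by grind),
      comp_ident (by grind)]
  rw [mix, choice, ← comp_assoc (by grind) (by grind), h, hs.cod_eq]

theorem mix_one (hs : IsState m s) (ht : IsState m t) : mix 1 s t = s := by
  have h := comp_discards t
  rw [ht.cod_eq, ht.dom_eq] at h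
  rw [mix_eq_mul_comp_choice hs ht, choice_one, mul_comp_mul (by grind) (by grind),
    comp_ident (by grind), h]
  exact mul_one s

theorem mix_comm (hs : IsState m s) (ht : IsState m t) (p : unitInterval) :
    mix p s t = mix (unitInterval.symm p) t s := by
  rw [mix_eq_mul_comp_choice hs ht, mix_eq_mul_comp_choice ht hs, choice_comm,
    ← comp_assoc (by grind) (by grind),
    state_mul_state_comp_swap hs.dom_eq ht.dom_eq hs.cod_eq ht.cod_eq]

theorem mix_zero (hs : IsState m s) (ht : IsState m t) : mix 0 s t = t := by
  rw [mix_comm hs ht, unitInterval.symm_zero, mix_one ht hs]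

theorem mix_assoc (hs : IsState m s) (ht : IsState m t) (hu : IsState m u)
    {p q r v : unitInterval} (hv : (p : ℝ) * q = v) (hr : (1 - (r : ℝ)) * (1 - v) = 1 - q) :
    mix q (mix p s t) u = mix v s (mix r t u) := by
  have h := congrArg (s * t * u ⨟ ·) (choice_assoc m hv hr)
  rw [mix_eq_mul_comp_choice (hs.mix ht p) hu, mix_eq_mul_comp_choice hs ht,
    mix_eq_mul_comp_choice hs (ht.mix hu r), mix_eq_mul_comp_choice ht hu]
  rw [← comp_assoc (by grind) (by grind), ← comp_assoc (by grind) (by grind),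
    mul_comp_mul (by grind) (by grind), comp_ident (by grind), mul_assoc,
    mul_comp_mul (by grind) (by grind), comp_ident (by grind)] at h
  exact h

/-- Postcomposition is affine, by naturality of the if-gate. -/
theorem mix_comp (hs : IsState m s) (ht : IsState m t) (p : unitInterval) {a : Circuit}
    (ha : a.dom = m) : mix p s t ⨟ a = mix p (s ⨟ a) (t ⨟ a) := by
  have h := ites_comp a
  rw [ha] at h
  rw [mix, mix, hs.cod_eq, cod_comp, comp_assoc (by grind) (by grind), h,
    ← comp_assoc (by grind) (by grind), mul_comp_mul (by grind) (by grind),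
    mul_comp_mul (by grind) (by grind), comp_ident (by grind)]

/-- The coin is plugged into `x` in the axiom that the if-gate sends `(1, x, 0)` to `x`. -/
theorem coin_eq_mix (p : unitInterval) : coin p = mix p (coin 1) (coin 0) := by
  have h := congrArg (coin p ⨟ ·) coin_mul_ident_mul_coin_comp_ites
  rw [comp_ident (by grind), ← comp_assoc (by grind) (by grind)] at h
  have h' : 1 * coin p * 1 ⨟ coin 1 * ident 1 * coin 0 = coin 1 * coin p * coin 0 := by
    rw [mul_comp_mul (by grind) (by grind), mul_comp_mul (by grind) (by grind),
      comp_ident (by grind), one_eq, ident_comp (by grind), ident_comp (by grind)]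
  rw [one_mul, mul_one] at h'
  rw [mix, cod_coin, ← h', h]

theorem exists_mix_assoc (p q : unitInterval) : ∃ v r : unitInterval, ∀ {m : ℕ} {s t u : Circuit},
    IsState m s → IsState m t → IsState m u → mix q (mix p s t) u = mix v s (mix r t u) := by
  obtain ⟨r, hr⟩ : ∃ r : unitInterval, (1 - (r : ℝ)) * (1 - (p * q : unitInterval)) = 1 - q := by
    have h : (p : ℝ) * q ≤ q := mul_le_of_le_one_left q.2.1 p.2.2
    rcases eq_or_lt_of_le (h.trans q.2.2) with h1 | h1
    -- If `p q = 1` then `q = 1`, and the equation holds for every `r`.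
    · refine ⟨0, ?_⟩
      rw [Set.Icc.coe_mul, h1]
      linarith [q.2.2]
    · have h2 : 0 < 1 - (p : ℝ) * q := by linarith
      refine ⟨⟨1 - (1 - q) / (1 - p * q), ?_, ?_⟩, ?_⟩
      · rw [sub_nonneg, div_le_one h2]
        linarith
      · have : 0 ≤ (1 - (q : ℝ)) / (1 - p * q) := div_nonneg (by linarith [q.2.2]) h2.le
        linarith
      · simp only [Set.Icc.coe_mul]
        rw [sub_sub_cancel, div_mul_cancel₀ _ h2.ne']
  exact ⟨p * q, r, fun hs ht hu => mix_assoc hs ht hu (by simp) hr⟩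

/-- The mirror image of `exists_mix_assoc` under commutativity. -/
theorem exists_mix_assoc' (v r : unitInterval) : ∃ q p : unitInterval, ∀ {m : ℕ} {s t u : Circuit},
    IsState m s → IsState m t → IsState m u → mix v s (mix r t u) = mix q (mix p s t) u := by
  obtain ⟨p, q, h⟩ := exists_mix_assoc (unitInterval.symm r) (unitInterval.symm v)
  refine ⟨unitInterval.symm p, unitInterval.symm q, fun hs ht hu => ?_⟩
  rw [mix_comm hs (ht.mix hu r), mix_comm ht hu, h hu ht hs, mix_comm hu (ht.mix hs q),
    mix_comm ht hs]

/-- The medial law of convex algebras: reassociate until `b` and `c` are adjacent, exchange them,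
and reassociate back. The weights themselves are never needed. -/
theorem exists_mix_mix (q p p' : unitInterval) : ∃ v v₁ v₂ : unitInterval,
    ∀ {m : ℕ} {a b c d : Circuit}, IsState m a → IsState m b → IsState m c → IsState m d →
      mix q (mix p a b) (mix p' c d) = mix v (mix v₁ a c) (mix v₂ b d) := by
  obtain ⟨q₁, p₁, h₁⟩ := exists_mix_assoc p q
  obtain ⟨q₂, p₂, h₂⟩ := exists_mix_assoc' p₁ p'
  obtain ⟨q₃, p₃, h₃⟩ := exists_mix_assoc (unitInterval.symm p₂) q₂
  obtain ⟨q₄, p₄, h₄⟩ := exists_mix_assoc' q₁ q₃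
  refine ⟨q₄, p₄, p₃, fun ha hb hc hd => ?_⟩
  rw [h₁ ha hb (hc.mix hd p'), h₂ hb hc hd, mix_comm hb hc, h₃ hc hb hd, h₄ ha hc (hb.mix hd p₃)]

/-! ### Points -/

/-- The deterministic state given by a bit. -/
def bit (b : Bool) : Circuit := coin (if b then 1 else 0)

theorem isState_bit (b : Bool) : IsState 1 (bit b) := ⟨rfl, rfl⟩

/-- The deterministic state given by a word of bits. -/
def point (x : List Bool) : Circuit := (x.map bit).prod

@[simp] theorem point_nil : point [] = 1 := rfl

@[simp] theorem point_cons (b : Bool) (x : List Bool) : point (b :: x) = bit b * point x := by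
  simp [point]

theorem point_append (x y : List Bool) : point (x ++ y) = point x * point y := by
  simp [point]

theorem isState_point (x : List Bool) : IsState x.length (point x) := by
  induction x with
  | nil => exact ⟨rfl, rfl⟩
  | cons b x ih =>
    rw [point_cons, List.length_cons, add_comm]
    exact (isState_bit b).mul ih

theorem bit_comp_copies (b : Bool) : bit b ⨟ copies 1 = bit b * bit b := by
  cases b
  · simpa [bit] using coin_zero_comp_copies
  · simpa [bit] using coin_one_comp_copies

theorem bits_comp_ites (a b c : Bool) :
    bit a * bit b * bit c ⨟ ites 1 = bit (if b then a else c) := by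
  cases b
  · simpa [mix, bit] using mix_zero (isState_bit a) (isState_bit c)
  · simpa [mix, bit] using mix_one (isState_bit a) (isState_bit c)

/-! ### Every state is a convex combination of points -/

/-- The states that are iterated convex combinations of points. -/
inductive IsConvex : ℕ → Circuit → Prop
  | point (x : List Bool) : IsConvex x.length (point x)
  | mix {m : ℕ} {s t : Circuit} (p : unitInterval) :
      IsConvex m s → IsConvex m t → IsConvex m (mix p s t)

theorem IsConvex.isState (h : IsConvex m s) : IsState m s := by
  induction h with
  | point x => exact isState_point x
  | mix p _ _ hs ht => exact hs.mix ht p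

theorem IsConvex.of_point {x : List Bool} (h : x.length = m) : IsConvex m (Circuit.point x) :=
  h ▸ .point x

/-- Since postcomposition is affine, convexity of the image need only be checked at points. -/
theorem IsConvex.comp_of_points (hs : IsConvex n s) {a : Circuit} (ha : a.dom = n)
    (h : ∀ x : List Bool, x.length = n → IsConvex m (Circuit.point x ⨟ a)) :
    IsConvex m (s ⨟ a) := by
  induction hs with
  | point x => exact h x rfl
  | mix p hs ht ihs iht =>
    rw [mix_comp hs.isState ht.isState p ha]
    exact .mix p (ihs ha h) (iht ha h)

theorem IsConvex.mul (hs : IsConvex n s) (ht : IsConvex m t) : IsConvex (n + m) (s * t) := by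
  have hs' := hs.isState
  have ht' := ht.isState
  rw [← comp_state_mul_ident hs'.dom_eq ht'.cod_eq]
  refine ht.comp_of_points (by grind) fun y hy => ?_
  rw [comp_state_mul_ident hs'.dom_eq ((isState_point y).cod_eq.trans hy),
    ← comp_ident_mul_state (isState_point y).dom_eq hs'.cod_eq]
  refine hs.comp_of_points (by simp [(isState_point y).dom_eq]) fun x hx => ?_
  rw [comp_ident_mul_state (isState_point y).dom_eq ((isState_point x).cod_eq.trans hx),
    ← point_append]
  exact .of_point (by simp [hx, hy])

/-- By `comp_of_points` it suffices to evaluate generators at points, where the axioms compute them;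
only the coin yields a proper mixture. -/
theorem IsConvex.comp {n m : ℕ} {s : Circuit} (hs : IsConvex n s) (f : Diagram n m) :
    IsConvex m (s ⨟ mk f) := by
  induction f generalizing s with
  | id n => rwa [mk_id, comp_ident hs.isState.cod_eq]
  | swap n m =>
    refine hs.comp_of_points rfl fun x hx => ?_
    obtain ⟨y, z, rfl, rfl, hz⟩ : ∃ y z, x = y ++ z ∧ y.length = n ∧ z.length = m :=
      ⟨x.take n, x.drop n, by simp, by simp [hx], by simp [hx]⟩
    rw [mk_swap, point_append, state_mul_state_comp_swap (isState_point y).dom_eq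
      (isState_point z).dom_eq (isState_point y).cod_eq ((isState_point z).cod_eq.trans hz),
      ← point_append]
    exact .of_point (by simp [hz])
  | seq f g hf hg =>
    rw [mk_seq, ← comp_assoc hs.isState.cod_eq rfl]
    exact hg (hf hs)
  | @par n m n' m' f g hf hg =>
    refine hs.comp_of_points rfl fun x hx => ?_
    obtain ⟨y, z, rfl, hy, hz⟩ : ∃ y z, x = y ++ z ∧ y.length = n ∧ z.length = n' :=
      ⟨x.take n, x.drop n, by simp, by simp [hx], by simp [hx]⟩
    rw [mk_par, point_append, mul_comp_mul (c := mk f) (d := mk g)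
      ((isState_point y).cod_eq.trans hy) ((isState_point z).cod_eq.trans hz)]
    exact (hf (.of_point hy)).mul (hg (.of_point hz))
  | discard =>
    refine hs.comp_of_points rfl fun x hx => ?_
    have := eq_one (a := Circuit.point x ⨟ mk .discard)
      (by simp [(isState_point x).dom_eq]) (by simp)
    rw [this]
    exact .point []
  | copy =>
    refine hs.comp_of_points rfl fun x hx => ?_
    obtain ⟨b, rfl⟩ := List.length_eq_one_iff.1 hx
    have := bit_comp_copies b
    rw [mk_copy, point_cons, point_nil, mul_one, this]
    simpa using IsConvex.point [b, b]
  | ite =>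
    refine hs.comp_of_points rfl fun x hx => ?_
    obtain ⟨a, b, c, rfl⟩ := List.length_eq_three.1 hx
    have := bits_comp_ites a b c
    rw [mk_ite]
    simp only [point_cons, point_nil, mul_one, ← mul_assoc, this]
    simpa using IsConvex.point [if b then a else c]
  | coin p =>
    rw [eq_one hs.isState.dom_eq hs.isState.cod_eq, one_eq, mk_coin, ident_comp (dom_coin p),
      coin_eq_mix]
    exact .mix p (by simpa [bit] using IsConvex.point [true])
      (by simpa [bit] using IsConvex.point [false])

theorem isConvex_of_isState (hs : IsState m s) : IsConvex m s := by
  obtain ⟨f, rfl⟩ := exists_rep hs.dom_eq hs.cod_eq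
  have := (IsConvex.point []).comp f
  rwa [point_nil, one_eq, ident_comp (by simp)] at this

theorem mix_state_mul {c : Circuit} (hc : c.dom = 0) (hs : IsState m s) (ht : IsState m t)
    (p : unitInterval) : mix p (c * s) (c * t) = c * mix p s t := by
  rw [← comp_state_mul_ident hc hs.cod_eq, ← comp_state_mul_ident hc ht.cod_eq,
    ← comp_state_mul_ident hc (hs.mix ht p).cod_eq, mix_comp hs ht p (by grind)]

/-- Conditioning on the first bit, by induction on the convex combination: in a mixture of two
states of this shape, the medial law collects the halves starting with `1` and those starting with
`0`. -/
theorem IsState.exists_eq_mix (hs : IsState (m + 1) s) : ∃ (p : unitInterval) (s₁ s₀ : Circuit),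
    IsState m s₁ ∧ IsState m s₀ ∧ s = Circuit.mix p (bit true * s₁) (bit false * s₀) := by
  have h := isConvex_of_isState hs
  generalize hk : m + 1 = k at h
  clear hs
  induction h with
  | point x =>
    cases x with
    | nil => simp at hk
    | cons b x =>
      obtain rfl : m = x.length := by simpa using hk
      have hx := isState_point x
      cases b
      -- A point is a degenerate mixture; the state of weight zero is arbitrary, so the tail `x` is
      -- reused.
      · exact ⟨0, _, _, hx, hx, by
          rw [mix_zero ((isState_bit _).mul hx) ((isState_bit _).mul hx), point_cons]⟩
      · exact ⟨1, _, _, hx, hx, by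
          rw [mix_one ((isState_bit _).mul hx) ((isState_bit _).mul hx), point_cons]⟩
  | @mix _ s t q _ _ hs ht =>
    obtain ⟨p, s₁, s₀, hs₁, hs₀, rfl⟩ := hs hk
    obtain ⟨p', t₁, t₀, ht₁, ht₀, rfl⟩ := ht hk
    obtain ⟨v, v₁, v₂, h⟩ := exists_mix_mix q p p'
    refine ⟨v, Circuit.mix v₁ s₁ t₁, Circuit.mix v₂ s₀ t₀, hs₁.mix ht₁ v₁, hs₀.mix ht₀ v₂, ?_⟩
    rw [h ((isState_bit _).mul hs₁) ((isState_bit _).mul hs₀) ((isState_bit _).mul ht₁)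
      ((isState_bit _).mul ht₀), mix_state_mul (isState_bit _).dom_eq hs₁ ht₁,
      mix_state_mul (isState_bit _).dom_eq hs₀ ht₀]

/-- A circuit is determined by its values at points. -/
theorem ext_point {a b : Circuit} (hd : a.dom = b.dom) (hc : a.cod = b.cod)
    (h : ∀ x : List Bool, x.length = a.dom → point x ⨟ a = point x ⨟ b) : a = b := by
  generalize hn : a.dom = n at hd h
  induction n generalizing a b with
  | zero =>
    have := h [] rfl
    rwa [point_nil, one_eq, ident_comp hn, ident_comp hd.symm] at this
  | succ n ih =>
    -- With the last input fixed to `c`, only `n` inputs remain and the induction hypothesis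
    -- applies.
    have key (c : Bool) : ident n * bit c ⨟ a = ident n * bit c ⨟ b := by
      have hb := isState_bit c
      refine ih (by grind) (by grind) (by grind) fun x hx => ?_
      have hp := isState_point x
      rw [← comp_assoc (by grind) (by grind), ← comp_assoc (by grind) (by grind),
        comp_ident_mul_state (by grind) (by grind)]
      simpa [point_append] using h (x ++ [c]) (by simp [hx])
    exact ext_last hn hd.symm hc (key true) (key false)

end Circuit

/-! ### Distributions of weighted coins -/

namespace BoolStoch

theorem ofFn_eq_append {n m : ℕ} (x : Bits (n + m)) :
    List.ofFn x = List.ofFn (fstBits x) ++ List.ofFn (sndBits x) := by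
  rw [← List.ofFn_fin_append]
  congr 1
  exact (Fin.append_castAdd_natAdd (f := x)).symm

theorem bind_coinPMF_apply {α : Type*} (p : unitInterval) (f : Bool → PMF α) (a : α) :
    (coinPMF p).bind f a = ENNReal.ofReal p * f true a + ENNReal.ofReal (1 - p) * f false a := by
  simp [PMF.bind_apply, tsum_fintype, coinPMF]

theorem coinPMF_one : coinPMF 1 = PMF.pure true := by
  ext b
  cases b <;> simp [coinPMF]

theorem coinPMF_zero : coinPMF 0 = PMF.pure false := by
  ext b
  cases b <;> simp [coinPMF]

theorem bind_coinPMF_symm {α : Type*} (p : unitInterval) (a b : PMF α) :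
    ((coinPMF (unitInterval.symm p)).bind fun c => if c = true then a else b) =
      (coinPMF p).bind fun c => if c = true then b else a := by
  ext x
  simp only [bind_coinPMF_apply, unitInterval.coe_symm_eq, if_true, Bool.false_eq_true, if_false,
    sub_sub_cancel, add_comm]

theorem bind_coinPMF_assoc {α : Type*} {p q r t : unitInterval} (ht : (p : ℝ) * q = t)
    (hr : (1 - (r : ℝ)) * (1 - t) = 1 - q) (a b c : PMF α) :
    ((coinPMF q).bind fun i => if i = true then
        (coinPMF p).bind fun j => if j = true then a else b else c) =
      (coinPMF t).bind fun i => if i = true then a else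
        (coinPMF r).bind fun j => if j = true then b else c := by
  ext x
  simp only [bind_coinPMF_apply, if_true, Bool.false_eq_true, if_false, mul_add, ← mul_assoc]
  rw [← ENNReal.ofReal_mul q.2.1, ← ENNReal.ofReal_mul q.2.1,
    ← ENNReal.ofReal_mul (sub_nonneg.2 t.2.2), ← ENNReal.ofReal_mul (sub_nonneg.2 t.2.2), add_assoc,
    mul_comm (1 - (t : ℝ)) (1 - r), hr, mul_comm (q : ℝ) p, ht]
  -- The coefficient of `b` remains: `q (1 - p) = (1 - t) r`, which follows from `ht` and `hr`.
  congr 4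
  linarith

end BoolStoch

/-! ### Semantics on lists of bits -/

namespace Diagram

open BoolStoch

/-- Semantics of diagrams as stochastic maps between lists of bits. -/
noncomputable def run : {n m : ℕ} → Diagram n m → List Bool → PMF (List Bool)
  | _, _, id _, l => PMF.pure l
  | _, _, swap n _, l => PMF.pure (l.drop n ++ l.take n)
  | _, _, seq f g, l => (run f l).bind (run g)
  | _, _, @par n _ _ _ f g, l =>
    (run f (l.take n)).bind fun a => (run g (l.drop n)).bind fun b => PMF.pure (a ++ b)
  | _, _, discard, _ => PMF.pure []
  | _, _, copy, l => PMF.pure (l ++ l)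
  -- The default `false` is never read on lists of length three.
  | _, _, ite, l => PMF.pure [if l.getD 1 false = true then l.getD 0 false else l.getD 2 false]
  | _, _, coin p, _ => (coinPMF p).map fun b => [b]

theorem run_ofFn {n m : ℕ} (f : Diagram n m) (x : Bits n) :
    f.run (List.ofFn x) = (f.den x).map List.ofFn := by
  induction f with
  | id n => simp [run, den, ident, BoolStoch.ofFun, PMF.pure_map]
  | swap n m =>
    simp [run, den, BoolStoch.swap, BoolStoch.ofFun, PMF.pure_map, ofFn_eq_append,
      List.ofFn_fin_append]
  | seq f g hf hg =>
    simp [run, den, BoolStoch.comp, hf, PMF.map_bind, PMF.bind_map, Function.comp_def, hg]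
  | par f g hf hg =>
    simp [run, den, BoolStoch.tensor, ofFn_eq_append, hf, hg, PMF.map_bind, PMF.bind_map,
      Function.comp_def, PMF.pure_map, List.ofFn_fin_append]
  | discard => simp [run, den, BoolStoch.discard, BoolStoch.ofFun, PMF.pure_map]
  | copy => simp [run, den, BoolStoch.copy, BoolStoch.ofFun, PMF.pure_map]
  | ite => simp [run, den, BoolStoch.ite, BoolStoch.ofFun, PMF.pure_map]
  | coin p => simp [run, den, BoolStoch.coin, PMF.map_comp, Function.comp_def]

theorem exists_ofFn_eq {n : ℕ} {l : List Bool} (hl : l.length = n) :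
    ∃ x : Bits n, List.ofFn x = l := by
  subst hl
  exact ⟨l.get, List.ofFn_get l⟩

theorem exists_run_eq {n m : ℕ} (f : Diagram n m) {l : List Bool} (hl : l.length = n) :
    ∃ d : PMF (Bits m), f.run l = d.map List.ofFn := by
  obtain ⟨x, rfl⟩ := exists_ofFn_eq hl
  exact ⟨f.den x, f.run_ofFn x⟩

/-- This moves the problem to lists, where casts disappear and reassociating words is associativity
of `++`. -/
theorem den_eq_den_iff {n m : ℕ} {f g : Diagram n m} :
    f.den = g.den ↔ ∀ l : List Bool, l.length = n → f.run l = g.run l := by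
  constructor
  · rintro h l hl
    obtain ⟨x, rfl⟩ := exists_ofFn_eq hl
    rw [run_ofFn, run_ofFn, h]
  · intro h
    funext x
    have := h (List.ofFn x) (by simp)
    rw [run_ofFn, run_ofFn] at this
    ext y
    have h' := congrArg (· (List.ofFn y)) this
    simpa [PMF.map_apply, List.ofFn_inj] using h'

/-- On a list of the right length, `run` is supported on lists of length `m`, so the continuations
need only agree there. -/
theorem bind_run_congr {n m : ℕ} {α : Type*} (f : Diagram n m) {l : List Bool} (hl : l.length = n)
    {k k' : List Bool → PMF α} (h : ∀ y : List Bool, y.length = m → k y = k' y) :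
    (f.run l).bind k = (f.run l).bind k' := by
  obtain ⟨d, hd⟩ := f.exists_run_eq hl
  rw [hd, PMF.bind_map, PMF.bind_map]
  congr 1
  funext y
  exact h _ (by simp)

@[simp] theorem run_cast {n m n' m' : ℕ} (f : Diagram n m) (hn : n = n') (hm : m = m')
    (l : List Bool) : (f.cast hn hm).run l = f.run l := by
  subst hn hm
  rfl

@[simp] theorem run_comp {n m m' k : ℕ} (f : Diagram n m) (g : Diagram m' k) (h : m = m')
    (l : List Bool) : (f.comp g h).run l = (f.run l).bind g.run := by
  subst h
  rfl

@[simp] theorem run_id (n : ℕ) (l : List Bool) : (id n).run l = PMF.pure l := rfl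

@[simp] theorem run_seq {n m k : ℕ} (f : Diagram n m) (g : Diagram m k) (l : List Bool) :
    (f.seq g).run l = (f.run l).bind g.run := rfl

@[simp] theorem run_coin (p : unitInterval) (l : List Bool) :
    (coin p).run l = (coinPMF p).map fun b => [b] := rfl

theorem run_par {n m n' m' : ℕ} (f : Diagram n m) (g : Diagram n' m') {l l₁ l₂ : List Bool}
    (hl : l = l₁ ++ l₂) (h : l₁.length = n) :
    (f ⊗ᵈ g).run l = (f.run l₁).bind fun a => (g.run l₂).bind fun b => PMF.pure (a ++ b) := by
  subst hl h
  simp [run]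

theorem run_swap {n m : ℕ} {l l₁ l₂ : List Bool} (hl : l = l₁ ++ l₂) (h : l₁.length = n) :
    (swap n m).run l = PMF.pure (l₂ ++ l₁) := by
  subst hl h
  simp [run]

theorem exists_append {l : List Bool} {n m : ℕ} (h : l.length = n + m) :
    ∃ l₁ l₂ : List Bool, l₁.length = n ∧ l₂.length = m ∧ l = l₁ ++ l₂ :=
  ⟨l.take n, l.drop n, by simp [h], by simp [h], by simp⟩

theorem run_discards (n : ℕ) {l : List Bool} (hl : l.length = n) :
    (discards n).run l = PMF.pure [] := by
  induction n using Nat.twoStepInduction generalizing l with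
  | zero => simp [discards, List.length_eq_zero_iff.1 hl]
  | one => rfl
  | more n _ ih =>
    obtain ⟨l₁, l₂, h₁, h₂, rfl⟩ := exists_append (n := n + 1) (m := 1) hl
    rw [discards, run_par _ _ rfl h₁, ih h₁]
    simp [run]

/-- Assuming only the values of `f` and `g` at the given lists serves both the recursion in `copies`
and the axiom `copy_par`; `run_iteTensor` has the same form. -/
theorem run_copyTensor {n m : ℕ} {f : Diagram n (n + n)} {g : Diagram m (m + m)}
    {l₁ l₂ : List Bool} (h₁ : l₁.length = n) (h₂ : l₂.length = m)
    (hf : f.run l₁ = PMF.pure (l₁ ++ l₁)) (hg : g.run l₂ = PMF.pure (l₂ ++ l₂)) :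
    (copyTensor f g).run (l₁ ++ l₂) = PMF.pure ((l₁ ++ l₂) ++ (l₁ ++ l₂)) := by
  rw [copyTensor, run_cast, run_comp, run_par _ _ rfl h₁, hf, hg, PMF.pure_bind, PMF.pure_bind,
    PMF.pure_bind, run_par (l₁ := l₁ ++ (l₁ ++ l₂)) (l₂ := l₂) _ _ (by simp) (by grind),
    run_par _ _ rfl h₁, run_swap rfl h₁]
  simp

theorem run_copies (n : ℕ) {l : List Bool} (hl : l.length = n) :
    (copies n).run l = PMF.pure (l ++ l) := by
  induction n using Nat.twoStepInduction generalizing l with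
  | zero => simp [copies, List.length_eq_zero_iff.1 hl]
  | one => rfl
  | more n _ ih =>
    obtain ⟨l₁, l₂, h₁, h₂, rfl⟩ := exists_append (n := n + 1) (m := 1) hl
    exact run_copyTensor h₁ h₂ (ih h₁) rfl

theorem run_iteTensor {n m : ℕ} {f : Diagram (n + 1 + n) n} {g : Diagram (m + 1 + m) m}
    {a a' c c' : List Bool} (b : Bool) (ha : a.length = n) (ha' : a'.length = m)
    (hc : c.length = n) (hc' : c'.length = m)
    (hf : f.run (a ++ [b] ++ c) = PMF.pure (if b = true then a else c))
    (hg : g.run (a' ++ [b] ++ c') = PMF.pure (if b = true then a' else c')) :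
    (iteTensor f g).run ((a ++ a') ++ [b] ++ (c ++ c')) =
      PMF.pure (if b = true then a ++ a' else c ++ c') := by
  have h1 : (id (n + m) ⊗ᵈ copy ⊗ᵈ id (n + m)).run ((a ++ a') ++ [b] ++ (c ++ c')) =
      PMF.pure (a ++ (a' ++ [b]) ++ ([b] ++ c) ++ c') := by
    rw [run_par (l₁ := (a ++ a') ++ [b]) _ _ rfl (by grind),
      run_par (l₁ := a ++ a') _ _ rfl (by grind)]
    simp [run]
  have h2 : (id n ⊗ᵈ swap m 1 ⊗ᵈ swap 1 n ⊗ᵈ id m).run (a ++ (a' ++ [b]) ++ ([b] ++ c) ++ c') =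
      PMF.pure ((a ++ [b]) ++ (a' ++ c) ++ ([b] ++ c')) := by
    rw [run_par (l₁ := a ++ (a' ++ [b]) ++ ([b] ++ c)) _ _ rfl (by grind),
      run_par (l₁ := a ++ (a' ++ [b])) _ _ rfl (by grind),
      run_par (l₁ := a) _ _ rfl ha, run_swap rfl ha', run_swap (n := 1) (l₁ := [b]) rfl rfl]
    simp
  have h3 : (id (n + 1) ⊗ᵈ swap m n ⊗ᵈ id (1 + m)).run ((a ++ [b]) ++ (a' ++ c) ++ ([b] ++ c')) =
      PMF.pure ((a ++ [b] ++ c) ++ (a' ++ [b] ++ c')) := by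
    rw [run_par (l₁ := (a ++ [b]) ++ (a' ++ c)) _ _ rfl (by grind),
      run_par (l₁ := a ++ [b]) _ _ rfl (by grind), run_swap rfl ha']
    simp
  rw [iteTensor, run_comp, run_comp, run_comp, h1, PMF.pure_bind, h2, PMF.pure_bind, h3,
    PMF.pure_bind, run_par _ _ rfl (by grind), hf, hg]
  cases b <;> simp

theorem run_ites (n : ℕ) {a c : List Bool} (b : Bool) (ha : a.length = n) (hc : c.length = n) :
    (ites n).run (a ++ [b] ++ c) = PMF.pure (if b = true then a else c) := by
  induction n using Nat.twoStepInduction generalizing a c with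
  | zero =>
    obtain rfl := List.length_eq_zero_iff.1 ha
    obtain rfl := List.length_eq_zero_iff.1 hc
    simp [ites, run]
  | one =>
    obtain ⟨a, rfl⟩ := List.length_eq_one_iff.1 ha
    obtain ⟨c, rfl⟩ := List.length_eq_one_iff.1 hc
    cases b <;> simp [ites, run]
  | more n _ ih =>
    obtain ⟨a, a', h₁, h₂, rfl⟩ := exists_append (n := n + 1) (m := 1) ha
    obtain ⟨c, c', h₃, h₄, rfl⟩ := exists_append (n := n + 1) (m := 1) hc
    refine run_iteTensor b h₁ h₂ h₃ h₄ (ih h₁ h₃) ?_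
    obtain ⟨a', rfl⟩ := List.length_eq_one_iff.1 h₂
    obtain ⟨c', rfl⟩ := List.length_eq_one_iff.1 h₄
    cases b <;> simp [run]

theorem run_choice (n : ℕ) (p : unitInterval) {l a c : List Bool} (hl : l = a ++ c)
    (ha : a.length = n) (hc : c.length = n) :
    (choice n p).run l =
      (coinPMF p).bind fun b => if b = true then PMF.pure a else PMF.pure c := by
  rw [choice, run_comp, run_par (l₁ := a) _ _ hl ha,
    run_par (l₁ := a) (l₂ := []) _ _ (by simp) ha]
  simp only [run_id, run_coin, PMF.pure_bind, PMF.bind_map, PMF.bind_bind, Function.comp_def,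
    run_ites n _ ha hc]
  congr 1
  funext b
  cases b <;> rfl

end Diagram

/-! ### Soundness -/

open Diagram BoolStoch in
theorem Derivable.run_eq {n m : ℕ} {f g : Diagram n m} (h : Derivable f g) :
    ∀ l : List Bool, l.length = n → f.run l = g.run l := by
  induction h with
  | refl f => exact fun _ _ => rfl
  | symm _ ih => exact fun l hl => (ih l hl).symm
  | trans _ _ ih ih' => exact fun l hl => (ih l hl).trans (ih' l hl)
  | seq_congr _ _ ih ih' =>
    intro l hl
    rw [run_seq, run_seq, ← ih l hl]
    exact bind_run_congr _ hl ih'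
  | par_congr _ _ ih ih' =>
    intro l hl
    obtain ⟨l₁, l₂, h₁, h₂, rfl⟩ := exists_append hl
    rw [run_par _ _ rfl h₁, run_par _ _ rfl h₁, ih l₁ h₁, ih' l₂ h₂]
  | seq_assoc f g h =>
    intro l hl
    exact PMF.bind_bind _ _ _
  | id_seq f =>
    intro l hl
    exact PMF.pure_bind _ _
  | seq_id f =>
    intro l hl
    exact PMF.bind_pure _
  | interchange f g f' g' =>
    intro l hl
    obtain ⟨l₁, l₂, h₁, h₂, rfl⟩ := exists_append hl
    rw [run_seq, run_par _ _ rfl h₁, run_par _ _ rfl h₁, run_seq, run_seq]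
    simp only [PMF.bind_bind, PMF.pure_bind]
    refine bind_run_congr f h₁ fun y hy => ?_
    -- Independent draws commute: `f'` is sampled before `g`.
    rw [PMF.bind_comm]
    refine bind_run_congr f' h₂ fun y' hy' => ?_
    rw [run_par _ _ rfl hy]
  | id_par_id n m =>
    intro l hl
    obtain ⟨l₁, l₂, h₁, h₂, rfl⟩ := exists_append hl
    rw [run_par _ _ rfl h₁]
    simp
  | unit_par f =>
    intro l hl
    rw [run_cast, run_par (l₁ := []) (l₂ := l) _ _ (by rfl) rfl]
    simp
  | par_unit f =>
    intro l hl
    rw [run_cast, run_par (l₁ := l) (l₂ := []) _ _ (by simp) hl]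
    simp
  | par_assoc f g h =>
    intro l hl
    obtain ⟨l₁, l', h₁, h', rfl⟩ := exists_append hl
    obtain ⟨l₂, l₃, h₂, h₃, rfl⟩ := exists_append h'
    rw [run_cast, run_par (l₁ := l₁ ++ l₂) (l₂ := l₃) _ _ (by simp) (by grind),
      run_par _ _ rfl h₁, run_par _ _ rfl h₁, run_par _ _ rfl h₂]
    simp
  | swap_swap n m =>
    intro l hl
    obtain ⟨l₁, l₂, h₁, h₂, rfl⟩ := exists_append hl
    rw [run_seq, run_swap rfl h₁, PMF.pure_bind, run_swap rfl h₂, run_id]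
  | swap_nat f k =>
    intro l hl
    obtain ⟨l₁, l₂, h₁, h₂, rfl⟩ := exists_append hl
    rw [run_seq, run_seq, run_par _ _ rfl h₁, run_swap rfl h₁, PMF.pure_bind, run_par _ _ rfl h₂]
    simp only [PMF.bind_bind, PMF.pure_bind, run_id]
    exact bind_run_congr f h₁ fun y hy => run_swap rfl hy
  | swap_par n m k =>
    intro l hl
    obtain ⟨l₁, l', h₁, h', rfl⟩ := exists_append hl
    obtain ⟨l₂, l₃, h₂, h₃, rfl⟩ := exists_append h'
    rw [run_cast, run_swap (l₁ := l₁ ++ l₂) (l₂ := l₃) (by simp) (by grind), run_comp,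
      run_par _ _ rfl h₁, run_swap rfl h₂]
    simp only [PMF.pure_bind, run_id]
    rw [run_par (l₁ := l₁ ++ l₃) (l₂ := l₂) _ _ (by simp) (by grind), run_swap rfl h₁]
    simp
  | copy_assoc n =>
    intro l hl
    simp only [run_comp, run_cast, run_copies n hl, PMF.pure_bind]
    rw [run_par _ _ rfl hl, run_par _ _ rfl hl, run_copies n hl]
    simp
  | copy_unit n =>
    intro l hl
    simp only [run_comp, run_cast, run_copies n hl, PMF.pure_bind]
    rw [run_par _ _ rfl hl, run_discards n hl]
    simp
  | copy_comm n =>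
    intro l hl
    rw [run_comp, run_copies n hl, PMF.pure_bind, run_swap rfl hl]
  | discard_nat f =>
    intro l hl
    rw [run_comp, run_discards _ hl, bind_run_congr f hl fun y hy => run_discards _ hy,
      PMF.bind_const]
  | discard_par n m =>
    intro l hl
    rw [run_discards _ hl]
    obtain ⟨l₁, l₂, h₁, h₂, rfl⟩ := exists_append hl
    rw [run_par _ _ rfl h₁, run_discards _ h₁, run_discards _ h₂]
    simp
  | copy_par n m =>
    intro l hl
    rw [run_copies _ hl]
    obtain ⟨l₁, l₂, h₁, h₂, rfl⟩ := exists_append hl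
    rw [run_copyTensor h₁ h₂ (run_copies _ h₁) (run_copies _ h₂)]
  | one_det =>
    intro l hl
    obtain rfl := List.length_eq_zero_iff.1 hl
    rw [run_comp, run_par (l₁ := []) (l₂ := []) _ _ (by rfl) rfl]
    simp [coinPMF_one, PMF.pure_map, run]
  | zero_det =>
    intro l hl
    obtain rfl := List.length_eq_zero_iff.1 hl
    rw [run_comp, run_par (l₁ := []) (l₂ := []) _ _ (by rfl) rfl]
    simp [coinPMF_zero, PMF.pure_map, run]
  | ite_bool =>
    intro l hl
    obtain ⟨b, rfl⟩ := List.length_eq_one_iff.1 hl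
    rw [run_cast, run_comp, run_par (l₁ := [b]) (l₂ := []) _ _ (by rfl) rfl,
      run_par (l₁ := []) (l₂ := [b]) _ _ (by rfl) rfl]
    simp [coinPMF_zero, coinPMF_one, PMF.pure_map, run]
  | ite_one n =>
    intro l hl
    obtain ⟨l₁, l₂, h₁, h₂, rfl⟩ := exists_append hl
    rw [run_choice n 1 rfl h₁ h₂, run_par _ _ rfl h₁, run_discards _ h₂]
    simp [coinPMF_one]
  | ite_assoc n p q r t ht hr =>
    intro l hl
    obtain ⟨l', l₃, h', h₃, rfl⟩ := exists_append hl
    obtain ⟨l₁, l₂, h₁, h₂, rfl⟩ := exists_append h'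
    have key := bind_coinPMF_assoc ht hr (PMF.pure l₁) (PMF.pure l₂) (PMF.pure l₃)
    rw [run_cast, run_comp, run_comp, run_par _ _ rfl h',
      run_par (l₁ := l₁) (l₂ := l₂ ++ l₃) _ _ (by simp) h₁, run_choice n p rfl h₁ h₂,
      run_choice n r rfl h₂ h₃]
    simp only [PMF.bind_bind, PMF.pure_bind, run_id]
    have e1 (b : Bool) : (if b = true then PMF.pure l₁ else PMF.pure l₂).bind
        (fun a => (choice n q).run (a ++ l₃)) =
        (coinPMF q).bind fun i => if i = true then if b = true then PMF.pure l₁ else PMF.pure l₂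
          else PMF.pure l₃ := by
      cases b
      · simp [run_choice n q rfl h₂ h₃]
      · simp [run_choice n q rfl h₁ h₃]
    have e2 (b : Bool) : (if b = true then PMF.pure l₂ else PMF.pure l₃).bind
        (fun a => (choice n t).run (l₁ ++ a)) =
        (coinPMF t).bind fun i => if i = true then PMF.pure l₁ else
          if b = true then PMF.pure l₂ else PMF.pure l₃ := by
      cases b
      · simp [run_choice n t rfl h₁ h₃]
      · simp [run_choice n t rfl h₁ h₂]
    simp only [e1, e2]
    -- The outer coin is drawn first, as in `key`; in the branch that ignores the inner coin, that
    -- draw is constant.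
    rw [PMF.bind_comm, PMF.bind_comm (coinPMF r)]
    convert key using 3 with i i <;> split_ifs <;> simp [PMF.bind_const]
  | ite_idem n =>
    intro l hl
    obtain ⟨l₁, l₂, h₁, h₂, rfl⟩ := exists_append hl
    obtain ⟨b, rfl⟩ := List.length_eq_one_iff.1 h₂
    rw [run_comp, run_comp, run_par _ _ rfl h₁, run_copies _ h₁, run_par _ _ rfl h₁]
    simp only [PMF.pure_bind, run_id]
    rw [run_par (l₁ := l₁) (l₂ := l₁ ++ [b]) _ _ (by simp) h₁, run_swap rfl h₁]
    simp only [PMF.pure_bind, run_id]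
    rw [← List.append_assoc, run_ites n b h₁ h₁]
    simp [run]
  | ite_comm n p =>
    intro l hl
    obtain ⟨l₁, l₂, h₁, h₂, rfl⟩ := exists_append hl
    rw [run_comp, run_swap rfl h₁, PMF.pure_bind, run_choice n _ rfl h₁ h₂,
      run_choice n _ rfl h₂ h₁, bind_coinPMF_symm]
  | ite_unit => exact fun _ _ => rfl
  | ite_par n m =>
    intro l hl
    obtain ⟨l', c, h', hc, rfl⟩ := exists_append hl
    obtain ⟨a, b, ha, hb, rfl⟩ := exists_append h'
    obtain ⟨b, rfl⟩ := List.length_eq_one_iff.1 hb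
    rw [run_ites _ b ha hc]
    obtain ⟨a, a', h₁, h₂, rfl⟩ := exists_append ha
    obtain ⟨c, c', h₃, h₄, rfl⟩ := exists_append hc
    rw [run_iteTensor b h₁ h₂ h₃ h₄ (run_ites n b h₁ h₃) (run_ites m b h₂ h₄)]
  | ite_nat f =>
    intro l hl
    obtain ⟨l', c, h', hc, rfl⟩ := exists_append hl
    obtain ⟨a, b, ha, hb, rfl⟩ := exists_append h'
    obtain ⟨b, rfl⟩ := List.length_eq_one_iff.1 hb
    rw [run_comp, run_comp, run_ites _ b ha hc, PMF.pure_bind, run_par _ _ rfl h',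
      run_par _ _ rfl ha]
    simp only [PMF.bind_bind, PMF.pure_bind, run_id]
    -- Running `f` on both branches and selecting one output leaves an unused draw, which has total
    -- mass one.
    have key := bind_run_congr f ha (k' := fun x => (f.run c).bind fun y =>
      PMF.pure (if b = true then x else y)) fun x hx =>
        bind_run_congr f hc fun y hy => run_ites _ b hx hy
    rw [key]
    cases b <;> simp

/-! ### States are determined by their distributions -/

namespace Circuit

open Diagram BoolStoch

/-- The distribution of a state (for other circuits, the value at the zero word). -/
noncomputable def dist (a : Circuit) : PMF (List Bool) :=
  Quotient.lift (fun f : Σ n m, Diagram n m => f.2.2.run (List.replicate f.1 false))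
    (by
      rintro _ _ ⟨h⟩
      exact h.run_eq _ (by simp)) a

theorem dist_mk {m : ℕ} (f : Diagram 0 m) : (mk f).dist = f.run [] := rfl

variable {m n : ℕ} {s t s' t' : Circuit}

theorem dist_mix (hs : IsState m s) (ht : IsState m t) (p : unitInterval) :
    (mix p s t).dist = (coinPMF p).bind fun b => if b = true then s.dist else t.dist := by
  obtain ⟨f, rfl⟩ := exists_rep hs.dom_eq hs.cod_eq
  obtain ⟨g, rfl⟩ := exists_rep ht.dom_eq ht.cod_eq
  have h : mix p (mk f) (mk g) = mk (seq (f ⊗ᵈ g) (.choice m p) : Diagram 0 m) := by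
    rw [mix_eq_mul_comp_choice hs ht, ← mk_choice, ← mk_par, ← mk_seq]
  rw [h, dist_mk, dist_mk, dist_mk, run_seq, run_par (l₁ := []) (l₂ := []) _ _ (by rfl) rfl]
  simp only [PMF.bind_bind, PMF.pure_bind]
  have key := bind_run_congr f (l := []) rfl (k' := fun x => (g.run []).bind fun y =>
    (coinPMF p).bind fun b => if b = true then PMF.pure x else PMF.pure y) fun x hx =>
      bind_run_congr g (l := []) rfl fun y hy => run_choice m p rfl hx hy
  rw [key]
  simp only [PMF.bind_comm _ (coinPMF p)]
  congr 1
  funext b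
  cases b <;> simp

theorem dist_bit_mul (hs : IsState m s) (b : Bool) :
    (bit b * s).dist = s.dist.map (b :: ·) := by
  obtain ⟨f, rfl⟩ := exists_rep hs.dom_eq hs.cod_eq
  have h : bit b * mk f = mk (.coin (if b = true then 1 else 0) ⊗ᵈ f) := rfl
  rw [h]
  change (Diagram.coin (if b = true then 1 else 0) ⊗ᵈ f).run [] = _
  rw [run_par (l₁ := []) (l₂ := []) _ _ (by rfl) rfl, dist_mk]
  cases b <;> simp [coinPMF_one, coinPMF_zero, PMF.map, Function.comp_def]

theorem dist_mix_apply (hs : IsState m s) (ht : IsState m t) (p : unitInterval) (l : List Bool) :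
    (mix p (bit true * s) (bit false * t)).dist (true :: l) = ENNReal.ofReal p * s.dist l ∧
    (mix p (bit true * s) (bit false * t)).dist (false :: l) =
      ENNReal.ofReal (1 - p) * t.dist l := by
  rw [dist_mix ((isState_bit _).mul hs) ((isState_bit _).mul ht), dist_bit_mul hs,
    dist_bit_mul ht]
  rw [bind_coinPMF_apply, bind_coinPMF_apply]
  simp [PMF.map_apply]

/-- Summing over `l` recovers the weight, and a nonzero finite weight cancels. -/
theorem eq_of_mul_pmf_eq {α : Type*} {a b : NNReal} {x y : PMF α}
    (h : ∀ l, (a : ENNReal) * x l = b * y l) : a = b ∧ (a ≠ 0 → x = y) := by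
  have hab : a = b := by
    have := tsum_congr (L := .unconditional α) h
    rwa [ENNReal.tsum_mul_left, ENNReal.tsum_mul_left, PMF.tsum_coe, PMF.tsum_coe, mul_one, mul_one,
      ENNReal.coe_inj] at this
  subst hab
  refine ⟨rfl, fun ha => PMF.ext fun l => ?_⟩
  exact (ENNReal.mul_right_inj (by simpa using ha) ENNReal.coe_ne_top).1 (h l)

/-- The probabilities of `true :: l` and `false :: l` are `p s₁(l)` and `(1 - p) s₀(l)`, so the
weight and the conditional distributions of nonzero weight can be read off. -/
theorem IsState.eq_of_dist_eq (hs : IsState m s) (ht : IsState m t) (h : s.dist = t.dist) :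
    s = t := by
  induction m generalizing s t with
  | zero => rw [eq_one hs.dom_eq hs.cod_eq, eq_one ht.dom_eq ht.cod_eq]
  | succ m ih =>
    obtain ⟨p, s₁, s₀, hs₁, hs₀, rfl⟩ := hs.exists_eq_mix
    obtain ⟨q, t₁, t₀, ht₁, ht₀, rfl⟩ := ht.exists_eq_mix
    have h₁ := eq_of_mul_pmf_eq (a := (p : ℝ).toNNReal) (b := (q : ℝ).toNNReal)
      (x := s₁.dist) (y := t₁.dist) fun l => by
        have := congrArg (· (true :: l)) h
        simpa only [ENNReal.ofReal, (dist_mix_apply hs₁ hs₀ p l).1, (dist_mix_apply ht₁ ht₀ q l).1]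
          using this
    have h₀ := eq_of_mul_pmf_eq (a := (1 - p : ℝ).toNNReal) (b := (1 - q : ℝ).toNNReal)
      (x := s₀.dist) (y := t₀.dist) fun l => by
        have := congrArg (· (false :: l)) h
        simpa only [ENNReal.ofReal, (dist_mix_apply hs₁ hs₀ p l).2, (dist_mix_apply ht₁ ht₀ q l).2]
          using this
    obtain rfl : p = q := Subtype.ext ((Real.toNNReal_eq_toNNReal_iff p.2.1 q.2.1).1 h₁.1)
    have b {x : Circuit} (c : Bool) (hx : IsState m x) := (isState_bit c).mul hx
    -- At `p = 0` or `p = 1` one conditional state is undetermined, but the mixture does not depend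
    -- on it.
    by_cases hp0 : p = 0
    · subst hp0
      rw [mix_zero (b _ hs₁) (b _ hs₀), mix_zero (b _ ht₁) (b _ ht₀), ih hs₀ ht₀ (h₀.2 (by simp))]
    by_cases hp1 : p = 1
    · subst hp1
      rw [mix_one (b _ hs₁) (b _ hs₀), mix_one (b _ ht₁) (b _ ht₀), ih hs₁ ht₁ (h₁.2 (by simp))]
    rw [ih hs₁ ht₁ (h₁.2 ?_), ih hs₀ ht₀ (h₀.2 ?_)]
    · have : (p : ℝ) < 1 := unitInterval.lt_one_iff_ne_one.2 hp1
      simpa using this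
    · have : 0 < (p : ℝ) := unitInterval.pos_iff_ne_zero.2 hp0
      simpa using this

/-- Any representative will do: its distribution depends only on its class, by soundness. -/
theorem exists_mk_eq_point (x : List Bool) :
    ∃ f : Diagram 0 x.length, mk f = point x ∧ f.run [] = PMF.pure x := by
  obtain ⟨f, hf⟩ := exists_rep (isState_point x).dom_eq (isState_point x).cod_eq
  refine ⟨f, hf, ?_⟩
  rw [← dist_mk, hf]
  clear hf f
  induction x with
  | nil => rfl
  | cons b x ih => rw [point_cons, dist_bit_mul (isState_point x), ih, PMF.pure_map]

end Circuit

/-! ### Soundness and completeness -/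

open Circuit in
theorem mainTheorem1 {n m : ℕ} (c d : Diagram n m) : c.den = d.den ↔ Derivable c d := by
  refine ⟨fun h => mk_eq_mk.1 (ext_point rfl rfl fun x hx => ?_),
    fun h => Diagram.den_eq_den_iff.2 h.run_eq⟩
  rw [dom_mk] at hx
  subst hx
  obtain ⟨f, hf, hr⟩ := exists_mk_eq_point x
  have hx := isState_point x
  -- The values at the point `x` are states, and their distributions are `c.run x` and `d.run x`.
  refine (hx.comp (cod_mk c)).eq_of_dist_eq (hx.comp (cod_mk d)) ?_
  rw [← hf, ← mk_seq, ← mk_seq, dist_mk, dist_mk, Diagram.run_seq, Diagram.run_seq, hr,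
    PMF.pure_bind, PMF.pure_bind]
  exact Diagram.den_eq_den_iff.1 h x rfl
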